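/- A metrized graph is a compact connected metric space $\Gamma$ such that every $x\in\Gamma$ has, for some integer $n\ge 1$ and some real $\epsilon>0$, an open neighbourhood isometric to the star $\{te^{2\pi i k/n} : 0\le t<\epsilon,\ k\in\mathbb{Z}\}\subset\mathbb{C}$ with its path metric, with $x$ corresponding to the centre $0$. Let $\delta(\Gamma)$ be its total length (one-dimensional Hausdorff measure) and let $dx$ be the length measure. For a continuous piecewise quadratic function $f$ on $\Gamma$ let \[ \Delta f=-f''\,dx-\sum_{x\in\Gamma}\Bigl(\sum_{v}d_vf(x)\Bigr)\delta_x, \] where $v$ runs over the directions emanating from $x$, $d_vf(x)$ is the outgoing slope, and $\delta_x$ is the Dirac measure at $x$. Let $r(x,y)$ be the effective resistance between $x$ and $y$, i.e. $r(x,y)=f(x)-f(y)$ where $\Delta f=\delta_x-\delta_y$. The canonical measure $\mu_{\mathrm{can}}$ and the tau-invariant $\tau(\Gamma)$ are defined by \[ \mu_{\mathrm{can}}(y)=\tfrac12\Delta_y r(x,y)+\delta_x(y),\qquad \tau(\Gamma)=\tfrac12\int_\Gamma r(x,y)\,\mu_{\mathrm{can}}(y), \] both being independent of $x\in\Gamma$.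 Let $g\ge 1$ be an integer and let $K$ be a polarization of genus $g$ on $\Gamma$, i.e. a divisor $K\in\mathbb{Z}^{(\Gamma)}$ of degree $2g-2$; write $\delta_K=\sum_x K(x)\,\delta_x$ and $\bar\Gamma=(\Gamma,K)$. Put $\mu_a=\frac1{2g}(\delta_K+2\mu_{\mathrm{can}})$, and let $g_\mu$ be the Green's function of $\mu_a$, i.e. the unique continuous function on $\Gamma\times\Gamma$ such that for all $x\in\Gamma$ the function $g_\mu(x,\cdot)$ is piecewise quadratic and \[ \Delta_y\,g_\mu(x,y)=\delta_x(y)-\mu_a(y),\qquad \int_\Gamma g_\mu(x,y)\,\mu_a(y)=0. \] Set \[ \varphi(\bar\Gamma)=-\tfrac14\delta(\Gamma)+\tfrac14\int_\Gamma g_\mu(x,x)\bigl((10g+2)\mu_a-\delta_K\bigr)(x),\qquad \varepsilon(\bar\Gamma)=\int_\Gamma g_\mu(x,x)\bigl((2g-2)\mu_a+\delta_K\bigr)(x). \] Proposition. Let $\bar\Gamma=(\Gamma,K)$ be a polarized metrized graph of genus $g\ge1$. Then $\delta=\delta(\Gamma)$ is finite, $r$, $\mu_{\mathrm{can}}$,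 $\tau=\tau(\Gamma)$ and $g_\mu$ are well defined (they exist and are unique), and, with $\varphi=\varphi(\bar\Gamma)$ and $\varepsilon=\varepsilon(\bar\Gamma)$, \[ \tfrac1{12}\bigl(\delta+\varepsilon-2\varphi\bigr)=\tfrac18\,\delta-\tfrac12\,\tau. \] -/

import Mathlib

open MeasureTheory Set

/-- A star chart of a metric space `Γ` centred at `x`: an open neighbourhood of `x` which is
isometric to the star `{t e^{2πik/n} : 0 ≤ t < ε, k ∈ ℤ}` with `n ≥ 1` arms, endowed with the path
metric, the point `x` being the centre `t = 0`. The point `t e^{2πik/n}` corresponds to `arm k t`;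
the values of `arm k` outside `[0, ε)` play no role. -/
structure StarChart {Γ : Type*} [MetricSpace Γ] (x : Γ) where
  n : ℕ
  n_pos : 0 < n
  ε : ℝ
  ε_pos : 0 < ε
  arm : Fin n → ℝ → Γ
  arm_zero : ∀ k, arm k 0 = x
  dist_same : ∀ k, ∀ s ∈ Ico 0 ε, ∀ t ∈ Ico 0 ε, dist (arm k s) (arm k t) = |s - t|
  dist_ne : ∀ k l, k ≠ l → ∀ s ∈ Ico 0 ε, ∀ t ∈ Ico 0 ε, dist (arm k s) (arm l t) = s + t
  isOpen_star : IsOpen {y : Γ | ∃ k, ∃ t ∈ Ico 0 ε, arm k t = y}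

/-- A metrized graph: a compact connected metric space in which every point has an open
neighbourhood isometric to a star. -/
class IsMetrizedGraph (Γ : Type*) [MetricSpace Γ] : Prop
    extends CompactSpace Γ, ConnectedSpace Γ where
  exists_starChart : ∀ x : Γ, Nonempty (StarChart x)

noncomputable section

namespace MetrizedGraph

section Functions

variable {Γ : Type*} [MetricSpace Γ]

/-- A continuous function on `Γ` is piecewise quadratic if, away from a finite set of points, it is
locally a polynomial of degree at most two in an arc length parameter `γ` around the point. -/
def IsPiecewiseQuadratic (f : Γ → ℝ) : Prop :=
  Continuous f ∧ ∃ S : Set Γ, S.Finite ∧ ∀ x ∉ S, ∃ δ > 0, ∃ γ : ℝ → Γ,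
    γ 0 = x ∧ (∀ s ∈ Ioo (-δ) δ, ∀ t ∈ Ioo (-δ) δ, dist (γ s) (γ t) = |s - t|) ∧
    IsOpen (γ '' Ioo (-δ) δ) ∧
    ∃ a b c : ℝ, ∀ t ∈ Ioo (-δ) δ, f (γ t) = a * t ^ 2 + b * t + c

/-- A star chart centred at `x`. Any two of them agree near `x` up to a permutation of the arms. -/
def starChart [IsMetrizedGraph Γ] (x : Γ) : StarChart x :=
  Classical.choice (IsMetrizedGraph.exists_starChart x)

/-- The sum of the outgoing slopes of `f` at `x`, one for each arm emanating from `x`. -/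
def slopeSum [IsMetrizedGraph Γ] (f : Γ → ℝ) (x : Γ) : ℝ :=
  ∑ k, derivWithin (fun t => f ((starChart x).arm k t)) (Ici 0) 0

/-- The second derivative of `f` at `x` with respect to arc length, computed along the first arm of
a star chart. At a point with two arms near which `f` is twice continuously differentiable, it does
not depend on the choice of the arm. -/
def secondDeriv [IsMetrizedGraph Γ] (f : Γ → ℝ) (x : Γ) : ℝ :=
  iteratedDerivWithin 2 (fun t => f ((starChart x).arm ⟨0, (starChart x).n_pos⟩ t)) (Ici 0) 0

end Functions

section Invariants

variable {Γ : Type*} [MetricSpace Γ] [MeasurableSpace Γ] [BorelSpace Γ]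

variable (Γ) in
/-- The total length of `Γ`, i.e. its one-dimensional Hausdorff measure. -/
def totalLength : ℝ := (μH[1] (univ : Set Γ)).toReal

/-- The Dirac measure at `x`, as a signed measure. -/
abbrev diracAt (x : Γ) : SignedMeasure Γ := VectorMeasure.dirac x 1

/-- The signed measure `δ_K = ∑ K(x) δ_x` of a divisor `K`. -/
def divisorMeasure (K : Γ →₀ ℤ) : SignedMeasure Γ := K.sum fun x m => (m : ℝ) • diracAt x

variable [IsMetrizedGraph Γ]

/-- The Laplacian `Δf = - f'' dx - ∑_x (sum of the outgoing slopes of f at x) δ_x` of a piecewise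
quadratic function `f`, where `dx` is the length measure. -/
def laplacian (f : Γ → ℝ) : SignedMeasure Γ :=
  - (μH[1] : Measure Γ).withDensityᵥ (secondDeriv f) - ∑ᶠ x, slopeSum f x • diracAt x

/-- `R` is the effective resistance between `x` and `y`: if a unit current enters the electric
circuit `Γ` at `x` and leaves it at `y`, then the potential `f`, which satisfies
`Δf = δ_x - δ_y`, drops by `R` from `x` to `y`. -/
def IsEffectiveResistance (x y : Γ) (R : ℝ) : Prop :=
  ∃ f : Γ → ℝ, IsPiecewiseQuadratic f ∧ laplacian f = diracAt x - diracAt y ∧ R = f x - f y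

/-- The effective resistance `r(x, y)`. -/
def resistance (x y : Γ) : ℝ := Classical.epsilon (IsEffectiveResistance x y)

/-- `μ = (1/2) Δ_y r(x, y) + δ_x`, for every base point `x`. -/
def IsCanonicalMeasure (μ : SignedMeasure Γ) : Prop :=
  ∀ x : Γ, IsPiecewiseQuadratic (resistance x) ∧
    μ = (1 / 2 : ℝ) • laplacian (resistance x) + diracAt x

variable (Γ) in
/-- The canonical measure `μ_can` of `Γ`. -/
def canonicalMeasure : SignedMeasure Γ := Classical.epsilon IsCanonicalMeasure

variable (Γ) in
/-- `t = (1/2) ∫ r(x, y) μ_can(y)`, for every base point `x`. -/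
def IsTauInvariant (t : ℝ) : Prop :=
  ∀ x : Γ, t = (1 / 2) * ∫ᵛ y, resistance x y ∂•(canonicalMeasure Γ)

variable (Γ) in
/-- The tau-invariant of `Γ`. -/
def tau : ℝ := Classical.epsilon (IsTauInvariant Γ)

/-- A divisor `K` on `Γ` is a polarization of genus `g ≥ 1` if it has degree `2g - 2`. -/
def IsPolarization (g : ℕ) (K : Γ →₀ ℤ) : Prop :=
  1 ≤ g ∧ (K.sum fun _ m => m) = 2 * (g : ℤ) - 2

/-- The admissible measure `μ_a = (1/2g) (δ_K + 2 μ_can)` of a polarized metrized graph. -/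
def admissibleMeasure (g : ℕ) (K : Γ →₀ ℤ) : SignedMeasure Γ :=
  (1 / (2 * (g : ℝ))) • (divisorMeasure K + (2 : ℝ) • canonicalMeasure Γ)

/-- `G` is a Green's function for `μ_a`: it is continuous on `Γ × Γ`, and for all `x` the function
`G(x, ·)` is piecewise quadratic with `Δ_y G(x, y) = δ_x - μ_a` and `∫ G(x, y) μ_a(y) = 0`. -/
def IsGreenFunction (g : ℕ) (K : Γ →₀ ℤ) (G : Γ → Γ → ℝ) : Prop :=
  Continuous (Function.uncurry G) ∧ ∀ x : Γ, IsPiecewiseQuadratic (G x) ∧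
    laplacian (G x) = diracAt x - admissibleMeasure g K ∧
    ∫ᵛ y, G x y ∂•(admissibleMeasure g K) = 0

/-- The Green's function `g_μ` of a polarized metrized graph. -/
def greenFunction (g : ℕ) (K : Γ →₀ ℤ) : Γ → Γ → ℝ := Classical.epsilon (IsGreenFunction g K)

/-- The invariant `φ = -(1/4) δ(Γ) + (1/4) ∫ g_μ(x, x) ((10g + 2) μ_a - δ_K)`. -/
def phi (g : ℕ) (K : Γ →₀ ℤ) : ℝ :=
  -(1 / 4) * totalLength Γ + (1 / 4) * ∫ᵛ x, greenFunction g K x x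
    ∂•((10 * (g : ℝ) + 2) • admissibleMeasure g K - divisorMeasure K)

/-- The invariant `ε = ∫ g_μ(x, x) ((2g - 2) μ_a + δ_K)`. -/
def epsilon (g : ℕ) (K : Γ →₀ ℤ) : ℝ :=
  ∫ᵛ x, greenFunction g K x x
    ∂•((2 * (g : ℝ) - 2) • admissibleMeasure g K + divisorMeasure K)

end Invariants

end MetrizedGraph

end

/-! Write D = `divisorPotential g K`, the sum of (K(z)/2g) r(z, ·). Since Δr(z, ·) = 2(μ_can − δ_z),
the function D has Laplacian 2μ_can − 2μ_a. So −½r(x, y) + ½D(x) + ½D(y) + c has the Laplacian in y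
required of g_μ, and the normalization fixes c = τ/g − ½∫D μ_a. As r(x, x) = 0, this gives g_μ(x, x)
= D(x) + c.

Put a = ∫g_μ(x, x)μ_a and b = ∫g_μ(x, x)μ_can. Both measures have mass 1 and ∫D μ_can = 2τ(g − 1)/g,
so a + b = 2τ (`integral_greenFunction_self_add`). Substituting δ_K = 2gμ_a − 2μ_can gives ε = (4g −
2)a − 2b and φ = −δ/4 + (2g + ½)a + ½b. Hence ε − 2φ = δ/2 − 3(a + b) = δ/2 − 6τ, which is the
identity.

Most of the work is potential theory on Γ without choosing a graph model. Piecewise quadratic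
functions are exactly those with a quadratic germ at every point (`HasGerms`). Uniqueness of
potentials up to constants is the maximum principle `eq_of_slopeSum_eq_zero`. Existence is by linear
duality (`diracAt_sub_mem_greenSubmodule`): a linear functional on signed measures that kills the
Laplacians of small tents is harmonic as a function of the position of a Dirac mass, hence constant.
The same argument carries Green's formula along with the potential.

A partition of unity shows that Laplacians have mass zero (`laplacian_univ`), so Green's formula
does not depend on the choice of potential. This yields the symmetry of the voltage function, and
through it r, μ_can and τ. The explicit dependence of the voltage on its source (`voltage_arm`)
gives joint continuity and shows that r(x, ·) is piecewise quadratic. -/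

noncomputable section

namespace MetrizedGraph

open Filter Topology

/-! ### Stars, arms and the local metric structure. -/

section Star

variable {Γ : Type*} [MetricSpace Γ] [IsMetrizedGraph Γ]

/-- The number of directions at `x`. -/
abbrev valence (x : Γ) : ℕ := (starChart x).n

/-- The `k`-th arm at `x`. -/
abbrev arm (x : Γ) (k : Fin (valence x)) (t : ℝ) : Γ := (starChart x).arm k t

/-- An arm index at `x`. -/
abbrev firstArm (x : Γ) : Fin (valence x) := ⟨0, (starChart x).n_pos⟩

/-- The open star contains a metric ball about its centre. Replacing the chart by this ball makes
the distance to `x` the parameter on every arm. -/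
theorem exists_radius (x : Γ) :
    ∃ R > 0, R ≤ (starChart x).ε ∧
      Metric.ball x R ⊆ {y : Γ | ∃ k, ∃ t ∈ Ico 0 (starChart x).ε, (starChart x).arm k t = y} := by
  have hx : x ∈ {y : Γ | ∃ k, ∃ t ∈ Ico 0 (starChart x).ε, (starChart x).arm k t = y} :=
    ⟨firstArm x, 0, ⟨le_rfl, (starChart x).ε_pos⟩, (starChart x).arm_zero _⟩
  obtain ⟨R, hR, h⟩ := Metric.isOpen_iff.1 (starChart x).isOpen_star x hx
  exact ⟨min R (starChart x).ε, lt_min hR (starChart x).ε_pos, min_le_right _ _,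
    (Metric.ball_subset_ball (min_le_left _ _)).trans h⟩

/-- A radius such that the ball around `x` of this radius is a star. -/
def radius (x : Γ) : ℝ := (exists_radius x).choose

theorem radius_pos (x : Γ) : 0 < radius x := (exists_radius x).choose_spec.1

theorem radius_le (x : Γ) : radius x ≤ (starChart x).ε := (exists_radius x).choose_spec.2.1

@[simp] theorem arm_zero (x : Γ) (k : Fin (valence x)) : arm x k 0 = x := (starChart x).arm_zero k

theorem dist_arm_same {x : Γ} (k : Fin (valence x)) {s t : ℝ} (hs : 0 ≤ s) (hs' : s < radius x)
    (ht : 0 ≤ t) (ht' : t < radius x) : dist (arm x k s) (arm x k t) = |s - t| :=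
  (starChart x).dist_same k s ⟨hs, hs'.trans_le (radius_le x)⟩ t ⟨ht, ht'.trans_le (radius_le x)⟩

theorem dist_arm_ne {x : Γ} {k l : Fin (valence x)} (h : k ≠ l) {s t : ℝ} (hs : 0 ≤ s)
    (hs' : s < radius x) (ht : 0 ≤ t) (ht' : t < radius x) :
    dist (arm x k s) (arm x l t) = s + t :=
  (starChart x).dist_ne k l h s ⟨hs, hs'.trans_le (radius_le x)⟩ t ⟨ht, ht'.trans_le (radius_le x)⟩

theorem dist_arm {x : Γ} (k : Fin (valence x)) {t : ℝ} (ht : 0 ≤ t) (ht' : t < radius x) :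
    dist x (arm x k t) = t := by
  have := dist_arm_same k le_rfl (radius_pos x) ht ht'
  rwa [arm_zero, zero_sub, abs_neg, abs_of_nonneg ht] at this

theorem exists_arm {x y : Γ} (h : dist x y < radius x) : ∃ k, arm x k (dist x y) = y := by
  obtain ⟨k, t, ht, rfl⟩ := (exists_radius x).choose_spec.2.2 (Metric.mem_ball'.2 h)
  have := (starChart x).dist_same k 0 ⟨le_rfl, (starChart x).ε_pos⟩ t ht
  rw [(starChart x).arm_zero, zero_sub, abs_neg, abs_of_nonneg ht.1] at this
  exact ⟨k, by rw [this]⟩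

theorem arm_injective {x : Γ} {k l : Fin (valence x)} {s t : ℝ} (hs : 0 < s) (hs' : s < radius x)
    (ht : 0 ≤ t) (ht' : t < radius x) (h : arm x k s = arm x l t) : k = l ∧ s = t := by
  have hst : s = t := by rw [← dist_arm k hs.le hs', ← dist_arm l ht ht', h]
  refine ⟨?_, hst⟩
  by_contra hkl
  have := dist_arm_ne hkl hs.le hs' ht ht'
  rw [h, dist_self] at this
  linarith

/-- A path through `y`, parametrized by arc length and with open image, follows exactly two arms
at `y`, and there are no further arms. -/
theorem exists_arms_eq_path {y : Γ} {δ : ℝ} (hδ : 0 < δ) {γ : ℝ → Γ} (h0 : γ 0 = y)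
    (hγ : ∀ s ∈ Ioo (-δ) δ, ∀ t ∈ Ioo (-δ) δ, dist (γ s) (γ t) = |s - t|)
    (ho : IsOpen (γ '' Ioo (-δ) δ)) :
    ∃ r > 0, r ≤ δ ∧ ∃ i j : Fin (valence y), i ≠ j ∧ (∀ l, l = i ∨ l = j) ∧
      ∀ s ∈ Ico 0 r, arm y i s = γ s ∧ arm y j s = γ (-s) := by
  obtain ⟨η, hη, hsub⟩ := Metric.isOpen_iff.1 ho y ⟨0, ⟨by linarith, hδ⟩, h0⟩
  set r := min δ (min η (radius y)) with hr
  have hrpos : 0 < r := lt_min hδ (lt_min hη (radius_pos y))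
  have hrδ : r ≤ δ := min_le_left _ _
  have hrη : r ≤ η := (min_le_right _ _).trans (min_le_left _ _)
  have hrR : r ≤ radius y := (min_le_right _ _).trans (min_le_right _ _)
  have hdist : ∀ u ∈ Ioo (-δ) δ, dist y (γ u) = |u| := fun u hu => by
    rw [← h0, hγ 0 ⟨by linarith, hδ⟩ u hu, zero_sub, abs_neg]
  have key : ∀ i, ∀ s ∈ Ico 0 r, arm y i s = γ s ∨ arm y i s = γ (-s) := by
    intro i s hs
    have hd := dist_arm i hs.1 (hs.2.trans_le hrR)
    obtain ⟨u, hu, hue⟩ := hsub (Metric.mem_ball'.2 (by rw [hd]; linarith [hs.2]) : arm y i s ∈ _)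
    have : |u| = s := by rw [← hdist u hu, hue, hd]
    rcases abs_eq hs.1 |>.1 this with h | h
    · left; rw [← hue, h]
    · right; rw [← hue, h]
  -- An arm cannot change sides: if it met γ(−s) and γ(t) with s, t > 0, these points would be at
  -- distance s + t along γ but |s − t| along the arm.
  have sgn : ∀ i, (∀ s ∈ Ico 0 r, arm y i s = γ s) ∨ (∀ s ∈ Ico 0 r, arm y i s = γ (-s)) := by
    intro i
    by_contra! hcon
    obtain ⟨⟨s, hs, hs'⟩, t, ht, ht'⟩ := hcon
    have es := (key i s hs).resolve_left hs'
    have et := (key i t ht).resolve_right ht'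
    have d1 := dist_arm_same i hs.1 (hs.2.trans_le hrR) ht.1 (ht.2.trans_le hrR)
    rw [es, et, hγ _ ⟨by linarith [hs.2], by linarith [hs.1]⟩ _
      ⟨by linarith [ht.1], by linarith [ht.2]⟩, abs_sub_comm, sub_neg_eq_add] at d1
    have hs0 : s ≠ 0 := by rintro rfl; exact hs' (by simpa using es)
    have ht0 : t ≠ 0 := by rintro rfl; exact ht' (by simpa using et)
    have p1 := lt_of_le_of_ne hs.1 hs0.symm
    have p2 := lt_of_le_of_ne ht.1 ht0.symm
    rw [abs_of_pos (by linarith)] at d1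
    rcases abs_cases (s - t) with h | h <;> linarith
  have hhalf : r / 2 ∈ Ico 0 r := ⟨by linarith, by linarith⟩
  have ex : ∀ u ∈ Ioo (-δ) δ, |u| = r / 2 → ∃ i, arm y i (r / 2) = γ u := by
    intro u hu hur
    have : dist y (γ u) = r / 2 := by rw [hdist u hu, hur]
    obtain ⟨i, hi⟩ := exists_arm (x := y) (y := γ u) (by rw [this]; linarith)
    exact ⟨i, by rw [← this, hi]⟩
  have hne : γ (r / 2) ≠ γ (-(r / 2)) := by
    intro h
    have := hγ (r / 2) ⟨by linarith, by linarith⟩ (-(r / 2)) ⟨by linarith, by linarith⟩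
    rw [h, dist_self, sub_neg_eq_add, abs_of_pos (by linarith)] at this
    linarith
  obtain ⟨i, hi⟩ := ex (r / 2) ⟨by linarith, by linarith⟩ (abs_of_pos (by linarith))
  obtain ⟨j, hj⟩ := ex (-(r / 2)) ⟨by linarith, by linarith⟩
    (by rw [abs_neg, abs_of_pos (by linarith)])
  have hi' : ∀ s ∈ Ico 0 r, arm y i s = γ s :=
    (sgn i).resolve_right fun h => hne (by rw [← hi, h _ hhalf])
  have hj' : ∀ s ∈ Ico 0 r, arm y j s = γ (-s) :=
    (sgn j).resolve_left fun h => hne (by rw [← hj, h _ hhalf])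
  refine ⟨r, hrpos, hrδ, i, j, fun h => hne (by rw [← hi, ← hj, h]), fun l => ?_,
    fun s hs => ⟨hi' s hs, hj' s hs⟩⟩
  have hr2 : r / 2 < radius y := by linarith
  rcases sgn l with h | h
  · left
    exact (arm_injective (by linarith) hr2 (by linarith) hr2 ((h _ hhalf).trans hi.symm)).1
  · right
    exact (arm_injective (by linarith) hr2 (by linarith) hr2 ((h _ hhalf).trans hj.symm)).1

/-- Along an arm, the balls are intervals. -/
theorem image_arm_eq_ball {x : Γ} (k : Fin (valence x)) {t δ : ℝ} (hδt : δ ≤ t)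
    (hδ : t + δ ≤ radius x) :
    (fun u => arm x k (t + u)) '' Ioo (-δ) δ = Metric.ball (arm x k t) δ := by
  ext z
  simp only [mem_image, mem_Ioo, Metric.mem_ball]
  constructor
  · rintro ⟨u, hu, rfl⟩
    rw [dist_arm_same k (by linarith) (by linarith) (by linarith) (by linarith), add_sub_cancel_left]
    exact abs_lt.2 hu
  · intro hz
    have hδ0 : 0 < δ := dist_nonneg.trans_lt hz
    have htd := dist_arm k (by linarith) (by linarith : t < radius x)
    have hzx : dist x z < radius x := by
      have := dist_triangle x (arm x k t) z
      rw [htd, dist_comm (arm x k t) z] at this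
      linarith
    obtain ⟨l, hl⟩ := exists_arm hzx
    set v := dist x z
    have hv : 0 ≤ v := dist_nonneg
    rw [← hl] at hz
    by_cases hkl : l = k
    · subst hkl
      rw [dist_arm_same l hv hzx (by linarith) (by linarith)] at hz
      refine ⟨v - t, ⟨by linarith [(abs_lt.1 hz).1], by linarith [(abs_lt.1 hz).2]⟩, ?_⟩
      rw [add_sub_cancel, hl]
    -- Another arm is reached only through the centre, at distance at least t ≥ δ, so it misses the
    -- ball.
    · rw [dist_arm_ne hkl hv hzx (by linarith) (by linarith)] at hz
      linarith

/-- An interior point of an arm has two arms, which run along the given arm. -/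
theorem exists_arms_eq_arm {x : Γ} (k : Fin (valence x)) {t : ℝ} (ht : 0 < t) (ht' : t < radius x) :
    ∃ r > 0, r ≤ t ∧ t + r ≤ radius x ∧ ∃ i j : Fin (valence (arm x k t)), i ≠ j ∧
      (∀ l, l = i ∨ l = j) ∧ ∀ s ∈ Ico 0 r,
        arm (arm x k t) i s = arm x k (t + s) ∧ arm (arm x k t) j s = arm x k (t - s) := by
  set δ := min t (radius x - t)
  have h1 : δ ≤ t := min_le_left _ _
  have h2 : δ ≤ radius x - t := min_le_right _ _
  have hδ : 0 < δ := lt_min ht (by linarith)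
  obtain ⟨r, hr, hrδ, i, j, hij, hall, h⟩ := exists_arms_eq_path (y := arm x k t) hδ
    (γ := fun u => arm x k (t + u)) (by simp)
    (fun s hs u hu => by
      rw [dist_arm_same k (by linarith [hs.1]) (by linarith [hs.2]) (by linarith [hu.1])
        (by linarith [hu.2]), add_sub_add_left_eq_sub])
    (by rw [image_arm_eq_ball k h1 (by linarith)]; exact Metric.isOpen_ball)
  exact ⟨r, hr, by linarith, by linarith, i, j, hij, hall, fun s hs => by
    simpa [sub_eq_add_neg] using h s hs⟩

end Star

/-! ### Quadratic germs and piecewise quadratic functions. -/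

section Germ

variable {Γ : Type*} [MetricSpace Γ] [IsMetrizedGraph Γ]

/-- Near `x`, the function `f` is given by `f x + b k * t + a k * t ^ 2` on the arm `k`. -/
def HasGerm (f : Γ → ℝ) (x : Γ) (a b : Fin (valence x) → ℝ) : Prop :=
  ∀ k, ∀ᶠ t in 𝓝[≥] (0 : ℝ), f (arm x k t) = f x + b k * t + a k * t ^ 2

theorem eventually_Ico {r : ℝ} (hr : 0 < r) : ∀ᶠ t in 𝓝[≥] (0 : ℝ), t ∈ Ico 0 r :=
  Ico_mem_nhdsGE hr

theorem exists_of_eventually_nhdsGE {p : ℝ → Prop} (h : ∀ᶠ t in 𝓝[≥] (0 : ℝ), p t) :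
    ∃ r > 0, ∀ t ∈ Ico 0 r, p t := by
  obtain ⟨r, hr, h⟩ := mem_nhdsGE_iff_exists_Ico_subset.1 h
  exact ⟨r, hr, h⟩

variable {f f' : Γ → ℝ} {x : Γ} {a b a' b' : Fin (valence x) → ℝ}

theorem HasGerm.exists_radius (h : HasGerm f x a b) :
    ∃ ρ > 0, ρ ≤ radius x ∧
      ∀ k, ∀ t ∈ Ico 0 ρ, f (arm x k t) = f x + b k * t + a k * t ^ 2 := by
  obtain ⟨r, hr, h⟩ := exists_of_eventually_nhdsGE (eventually_all.2 h)
  exact ⟨min r (radius x), lt_min hr (radius_pos x), min_le_right _ _,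
    fun k t ht => h t ⟨ht.1, ht.2.trans_le (min_le_left _ _)⟩ k⟩

theorem HasGerm.add (h : HasGerm f x a b) (h' : HasGerm f' x a' b') :
    HasGerm (f + f') x (a + a') (b + b') := fun k => by
  filter_upwards [h k, h' k] with t h1 h2
  simp only [Pi.add_apply, h1, h2]; ring

theorem HasGerm.smul (c : ℝ) (h : HasGerm f x a b) : HasGerm (c • f) x (c • a) (c • b) :=
  fun k => by
    filter_upwards [h k] with t h1
    simp only [Pi.smul_apply, smul_eq_mul, h1]; ring

theorem hasGerm_const (c : ℝ) (x : Γ) : HasGerm (fun _ => c) x 0 0 := fun k => by simp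

theorem hasDerivAt_quadratic (A B C t : ℝ) :
    HasDerivAt (fun u : ℝ => C + B * u + A * u ^ 2) (B + 2 * A * t) t := by
  have h := (((hasDerivAt_id t).const_mul B).const_add C).add
    (((hasDerivAt_id t).pow 2).const_mul A)
  exact h.congr_deriv (by simp; ring)

theorem HasGerm.hasDerivWithinAt (h : HasGerm f x a b) (k : Fin (valence x)) :
    HasDerivWithinAt (fun t => f (arm x k t)) (b k) (Ici 0) 0 := by
  have := (hasDerivAt_quadratic (a k) (b k) (f x) 0).hasDerivWithinAt (s := Ici 0)
  rw [mul_zero, add_zero] at this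
  exact this.congr_of_eventuallyEq (h k) (by simp)

theorem HasGerm.slopeSum_eq (h : HasGerm f x a b) : slopeSum f x = ∑ k, b k :=
  Finset.sum_congr rfl fun k _ => (h.hasDerivWithinAt k).derivWithin (uniqueDiffWithinAt_Ici 0)

theorem HasGerm.secondDeriv_eq (h : HasGerm f x a b) : secondDeriv f x = 2 * a (firstArm x) := by
  have h1 : (fun t => f (arm x (firstArm x) t)) =ᶠ[𝓝[Ici 0] 0]
      fun t => f x + b (firstArm x) * t + a (firstArm x) * t ^ 2 := h _
  have h2 := h1.iteratedDerivWithin_eq (n := 2) (by simp)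
  rw [secondDeriv]
  refine h2.trans ?_
  rw [iteratedDerivWithin_eq_iteratedDeriv (uniqueDiffOn_Ici 0) (by fun_prop) self_mem_Ici,
    iteratedDeriv_succ, iteratedDeriv_one]
  rw [funext fun t => (hasDerivAt_quadratic (a (firstArm x)) (b (firstArm x)) (f x) t).deriv]
  simp

/-- The germ of `f` at an interior point of an arm, in terms of the two directions on the arm. -/
theorem hasGerm_arm {x : Γ} {k : Fin (valence x)} {t : ℝ} (ht : 0 < t) (ht' : t < radius x)
    {a₁ b₁ a₂ b₂ : ℝ}
    (h₁ : ∀ᶠ s in 𝓝[≥] (0 : ℝ), f (arm x k (t + s)) = f (arm x k t) + b₁ * s + a₁ * s ^ 2)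
    (h₂ : ∀ᶠ s in 𝓝[≥] (0 : ℝ), f (arm x k (t - s)) = f (arm x k t) + b₂ * s + a₂ * s ^ 2) :
    ∃ a b : Fin (valence (arm x k t)) → ℝ, HasGerm f (arm x k t) a b ∧
      ∑ i, b i = b₁ + b₂ ∧ (∀ i, a i = a₁ ∧ b i = b₁ ∨ a i = a₂ ∧ b i = b₂) := by
  obtain ⟨r, hr, -, -, i, j, hij, hall, h⟩ := exists_arms_eq_arm k ht ht'
  refine ⟨fun l => if l = i then a₁ else a₂, fun l => if l = i then b₁ else b₂, fun l => ?_, ?_,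
    fun l => ?_⟩
  · rcases hall l with rfl | rfl
    · filter_upwards [h₁, eventually_Ico hr] with s hs hs'
      rw [(h s hs').1, hs]; simp
    · filter_upwards [h₂, eventually_Ico hr] with s hs hs'
      rw [(h s hs').2, hs]; simp [hij.symm]
  · have : (Finset.univ : Finset (Fin (valence (arm x k t)))) = {i, j} := by
      ext l; simpa using hall l
    rw [this, Finset.sum_pair hij]
    simp [hij.symm]
  · by_cases hl : l = i <;> simp [hl]

/-- If `f` is quadratic on an initial segment of an arm, then `f` is smooth at its interior points.
-/
theorem hasGerm_arm_of_quadratic {x : Γ} {k : Fin (valence x)} {ρ A B C : ℝ} (hρ : ρ ≤ radius x)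
    (h : ∀ t ∈ Ioo 0 ρ, f (arm x k t) = C + B * t + A * t ^ 2) {t : ℝ} (ht : t ∈ Ioo 0 ρ) :
    ∃ a b : Fin (valence (arm x k t)) → ℝ, HasGerm f (arm x k t) a b ∧
      ∑ i, b i = 0 ∧ (∀ i, a i = A) ∧ (∀ i, |b i| = |B + 2 * A * t|) := by
  have hd : 0 < min t (ρ - t) := lt_min ht.1 (by linarith [ht.2])
  -- Recentring the polynomial at `t` keeps the leading coefficient in both directions and gives
  -- opposite slopes, which cancel in the sum.
  obtain ⟨a, b, hg, hs, hab⟩ := hasGerm_arm (f := f) (k := k) ht.1 (ht.2.trans_le hρ)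
    (a₁ := A) (b₁ := B + 2 * A * t) (a₂ := A) (b₂ := -(B + 2 * A * t))
    (by
      filter_upwards [eventually_Ico hd] with s hs
      have := hs.2.trans_le (min_le_right _ _)
      rw [h _ ⟨by linarith [ht.1, hs.1], by linarith⟩, h _ ht]; ring)
    (by
      filter_upwards [eventually_Ico hd] with s hs
      have := hs.2.trans_le (min_le_left _ _)
      rw [h _ ⟨by linarith, by linarith [ht.2, hs.1]⟩, h _ ht]; ring)
  exact ⟨a, b, hg, by rw [hs]; ring, fun i => (hab i).elim And.left And.left,
    fun i => by rcases hab i with h | h <;> rw [h.2]; rw [abs_neg]⟩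

/-- Every point has a germ. -/
def HasGerms (f : Γ → ℝ) : Prop := ∀ x, ∃ a b : Fin (valence x) → ℝ, HasGerm f x a b

/-- Every point has a linear germ. -/
def HasLinearGerms (f : Γ → ℝ) : Prop := ∀ x, ∃ b : Fin (valence x) → ℝ, HasGerm f x 0 b

theorem HasLinearGerms.hasGerms (h : HasLinearGerms f) : HasGerms f := fun x =>
  let ⟨b, hb⟩ := h x; ⟨0, b, hb⟩

theorem HasGerms.add (h : HasGerms f) (h' : HasGerms f') : HasGerms (f + f') := fun x =>
  let ⟨_, _, hb⟩ := h x; let ⟨_, _, hb'⟩ := h' x; ⟨_, _, hb.add hb'⟩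

theorem HasGerms.smul (c : ℝ) (h : HasGerms f) : HasGerms (c • f) := fun x =>
  let ⟨_, _, hb⟩ := h x; ⟨_, _, hb.smul c⟩

theorem hasGerms_const (c : ℝ) : HasGerms (fun _ : Γ => c) := fun x => ⟨_, _, hasGerm_const c x⟩

theorem HasGerms.sub (h : HasGerms f) (h' : HasGerms f') : HasGerms (f - f') := by
  have := h.add (h'.smul (-1))
  rwa [neg_one_smul, ← sub_eq_add_neg] at this

theorem HasGerms.sum {ι : Type*} (s : Finset ι) {F : ι → Γ → ℝ} (h : ∀ i, HasGerms (F i)) :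
    HasGerms (∑ i ∈ s, F i) := by
  classical
  induction s using Finset.induction_on with
  | empty => exact hasGerms_const 0
  | insert i s hi ih => rw [Finset.sum_insert hi]; exact (h i).add ih

theorem HasGerms.continuous (h : HasGerms f) : Continuous f := by
  rw [continuous_iff_continuousAt]
  intro x
  obtain ⟨a, b, hg⟩ := h x
  obtain ⟨ρ, hρ, hρR, hq⟩ := hg.exists_radius
  set M := ∑ k, (|b k| + |a k| * ρ)
  have hM : ∀ y ∈ Metric.ball x ρ, dist (f y) (f x) ≤ M * dist y x := by
    intro y hy
    rw [Metric.mem_ball'] at hy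
    obtain ⟨k, hk⟩ := exists_arm (hy.trans_le hρR)
    rw [dist_comm y x]
    set t := dist x y
    have ht : 0 ≤ t := dist_nonneg
    rw [← hk, hq k t ⟨ht, hy⟩, Real.dist_eq]
    have h1 : f x + b k * t + a k * t ^ 2 - f x = (b k + a k * t) * t := by ring
    rw [h1, abs_mul, abs_of_nonneg ht]
    refine mul_le_mul_of_nonneg_right ?_ ht
    calc |b k + a k * t| ≤ |b k| + |a k * t| := abs_add_le _ _
      _ ≤ |b k| + |a k| * ρ := by rw [abs_mul, abs_of_nonneg ht]; gcongr
      _ ≤ M := Finset.single_le_sum (f := fun k => |b k| + |a k| * ρ)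
          (fun i _ => by positivity) (Finset.mem_univ k)
  rw [ContinuousAt, tendsto_iff_dist_tendsto_zero]
  refine squeeze_zero' (Eventually.of_forall fun _ => dist_nonneg)
    (eventually_of_mem (Metric.ball_mem_nhds x hρ) hM) ?_
  have : Tendsto (fun y => M * dist y x) (𝓝 x) (𝓝 (M * dist x x)) :=
    (continuous_const.mul (continuous_id.dist continuous_const)).tendsto x
  simpa using this

/-- Finitely many balls of prescribed radii cover the graph. -/
theorem exists_finset_cover {ρ : Γ → ℝ} (hρ : ∀ x, 0 < ρ x) :
    ∃ s : Finset Γ, ∀ y, ∃ x ∈ s, dist x y < ρ x := by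
  obtain ⟨s, hs⟩ := CompactSpace.elim_nhds_subcover (fun x => Metric.ball x (ρ x))
    fun x => Metric.ball_mem_nhds x (hρ x)
  refine ⟨s, fun y => ?_⟩
  have : y ∈ ⋃ x ∈ s, Metric.ball x (ρ x) := by rw [hs]; trivial
  simp only [mem_iUnion, Metric.mem_ball'] at this
  simpa using this

/-- If every point has a punctured neighbourhood on which `p` holds, then `p` holds off a finite
set. -/
theorem finite_not_of_punctured {p : Γ → Prop}
    (h : ∀ x, ∃ ρ > 0, ρ ≤ radius x ∧ ∀ k, ∀ t ∈ Ioo 0 ρ, p (arm x k t)) : {y | ¬ p y}.Finite := by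
  choose ρ hρ hρR hp using h
  obtain ⟨s, hs⟩ := exists_finset_cover hρ
  refine s.finite_toSet.subset fun y hy => ?_
  obtain ⟨x, hx, hxy⟩ := hs y
  rcases eq_or_ne x y with rfl | hne
  · exact hx
  · obtain ⟨k, hk⟩ := exists_arm (hxy.trans_le (hρR x))
    exact absurd (hk ▸ hp x k _ ⟨dist_pos.2 hne, hxy⟩) hy

/-- Inside a star where the germ is valid, the arm itself serves as arc length parameter at every
point but the centre. Exceptional points are therefore isolated, and compactness makes them finite
in number. -/
theorem HasGerms.isPiecewiseQuadratic (h : HasGerms f) : IsPiecewiseQuadratic f := by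
  refine ⟨h.continuous, _, finite_not_of_punctured (p := fun x => ∃ δ > 0, ∃ γ : ℝ → Γ,
    γ 0 = x ∧ (∀ s ∈ Ioo (-δ) δ, ∀ t ∈ Ioo (-δ) δ, dist (γ s) (γ t) = |s - t|) ∧
    IsOpen (γ '' Ioo (-δ) δ) ∧
    ∃ a b c : ℝ, ∀ t ∈ Ioo (-δ) δ, f (γ t) = a * t ^ 2 + b * t + c) ?_,
    fun x hx => not_not.1 hx⟩
  intro x
  obtain ⟨a, b, hg⟩ := h x
  obtain ⟨ρ, hρ, hρR, hq⟩ := hg.exists_radius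
  refine ⟨ρ, hρ, hρR, fun k t ht => ?_⟩
  have h1 : min t (ρ - t) ≤ t := min_le_left _ _
  have h2 : min t (ρ - t) ≤ ρ - t := min_le_right _ _
  refine ⟨min t (ρ - t), lt_min ht.1 (by linarith [ht.2]), fun u => arm x k (t + u), by simp,
    fun s hs u hu => ?_, ?_, a k, b k + 2 * a k * t, f x + b k * t + a k * t ^ 2, fun u hu => ?_⟩
  · rw [dist_arm_same k (by linarith [hs.1]) (by linarith [hs.2]) (by linarith [hu.1])
        (by linarith [hu.2]), add_sub_add_left_eq_sub]
  · rw [image_arm_eq_ball k h1 (by linarith)]; exact Metric.isOpen_ball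
  · rw [hq k _ ⟨by linarith [hu.1], by linarith [hu.2]⟩]; ring

/-- Near `x` only `x` itself can be exceptional, so `f` is locally polynomial on each open arm,
hence analytic. The identity theorem yields a single quadratic polynomial on the whole arm, and
continuity forces its constant term to be `f x`. -/
theorem IsPiecewiseQuadratic.hasGerms (h : IsPiecewiseQuadratic f) : HasGerms f := by
  obtain ⟨hc, S, hS, hloc⟩ := h
  intro x
  obtain ⟨ρ, hρ, hρR, hSρ⟩ : ∃ ρ > 0, ρ ≤ radius x ∧ ∀ y ∈ S, dist x y < ρ → y = x := by
    have : ∀ᶠ y in 𝓝 x, y ∉ S \ {x} :=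
      (hS.subset sdiff_subset).isClosed.isOpen_compl.mem_nhds (by simp)
    obtain ⟨ρ, hρ, hb⟩ := Metric.eventually_nhds_iff.1 this
    refine ⟨min ρ (radius x), lt_min hρ (radius_pos x), min_le_right _ _, fun y hy hd => ?_⟩
    by_contra hne
    exact hb (by rw [dist_comm]; exact hd.trans_le (min_le_left _ _)) ⟨hy, hne⟩
  suffices H : ∀ k, ∃ A B C : ℝ, ∀ t ∈ Ioo 0 ρ, f (arm x k t) = C + B * t + A * t ^ 2 by
    choose A B C hABC using H
    have hC : ∀ k, f x = C k := by
      intro k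
      have h1 : Tendsto (fun t => f (arm x k t)) (𝓝[>] 0) (𝓝 (f x)) := by
        refine hc.continuousAt.tendsto.comp ?_
        rw [tendsto_iff_dist_tendsto_zero]
        have : Tendsto (fun t : ℝ => t) (𝓝[>] 0) (𝓝 0) := tendsto_id.mono_left nhdsWithin_le_nhds
        refine this.congr' ?_
        filter_upwards [Ioo_mem_nhdsGT (radius_pos x)] with t ht
        rw [dist_comm, dist_arm k ht.1.le ht.2]
      have h2 : Tendsto (fun t => f (arm x k t)) (𝓝[>] 0) (𝓝 (C k)) := by
        have : Tendsto (fun t : ℝ => C k + B k * t + A k * t ^ 2) (𝓝[>] 0)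
            (𝓝 (C k + B k * 0 + A k * 0 ^ 2)) :=
          ((by fun_prop : Continuous fun t : ℝ => C k + B k * t + A k * t ^ 2).tendsto 0).mono_left
            nhdsWithin_le_nhds
        simp only [mul_zero, add_zero, ne_eq, OfNat.ofNat_ne_zero, not_false_eq_true,
          zero_pow] at this
        refine this.congr' ?_
        filter_upwards [Ioo_mem_nhdsGT hρ] with t ht
        rw [hABC k t ht]
      exact tendsto_nhds_unique h1 h2
    refine ⟨A, B, fun k => ?_⟩
    filter_upwards [eventually_Ico hρ] with t ht
    rcases eq_or_lt_of_le ht.1 with rfl | h0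
    · simp
    · rw [hABC k t ⟨h0, ht.2⟩, hC k]
  intro k
  set F : ℝ → ℝ := fun t => f (arm x k t)
  have key : ∀ t ∈ Ioo 0 ρ, ∃ A B C : ℝ, F =ᶠ[𝓝 t] fun u => C + B * u + A * u ^ 2 := by
    intro t ht
    have htR : t < radius x := ht.2.trans_le hρR
    have hne : arm x k t ∉ S := by
      intro hmem
      have h1 := dist_arm k ht.1.le htR
      have h2 := hSρ _ hmem (by rw [h1]; exact ht.2)
      rw [h2, dist_self] at h1
      linarith [ht.1]
    obtain ⟨δ, hδ, γ, h0, hiso, hopen, a, b, c, hq⟩ := hloc _ hne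
    obtain ⟨r, hr, hrδ, i, j, hij, hall, h1⟩ := exists_arms_eq_path hδ h0 hiso hopen
    obtain ⟨r', hr', hrt, -, i', j', hij', -, h2⟩ := exists_arms_eq_arm k ht.1 htR
    -- Both the path γ and the given arm follow the only two arms at this point, so they agree up to
    -- the orientation σ.
    have hsub : ∃ σ : ℝ, (σ = 1 ∨ σ = -1) ∧ ∀ u, |u| < min r r' → arm x k (t + u) = γ (σ * u) := by
      have hcase : (i' = i ∧ j' = j) ∨ (i' = j ∧ j' = i) := by
        rcases hall i' with h | h <;> rcases hall j' with h' | h'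
        · exact absurd (h.trans h'.symm) hij'
        · exact Or.inl ⟨h, h'⟩
        · exact Or.inr ⟨h, h'⟩
        · exact absurd (h.trans h'.symm) hij'
      have aux : ∀ u, |u| < min r r' → |u| ∈ Ico 0 r ∧ |u| ∈ Ico 0 r' := fun u hu =>
        ⟨⟨abs_nonneg _, hu.trans_le (min_le_left _ _)⟩, ⟨abs_nonneg _, hu.trans_le (min_le_right _ _)⟩⟩
      rcases hcase with ⟨rfl, rfl⟩ | ⟨rfl, rfl⟩
      · refine ⟨1, Or.inl rfl, fun u hu => ?_⟩
        obtain ⟨m1, m2⟩ := aux u hu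
        rcases abs_cases u with ⟨e, -⟩ | ⟨e, -⟩ <;> rw [e] at m1 m2
        · rw [← (h2 u m2).1, (h1 u m1).1, one_mul]
        · rw [one_mul, ← neg_neg u, ← (h1 _ m1).2, (h2 _ m2).2, sub_eq_add_neg]
      · refine ⟨-1, Or.inr rfl, fun u hu => ?_⟩
        obtain ⟨m1, m2⟩ := aux u hu
        rcases abs_cases u with ⟨e, -⟩ | ⟨e, -⟩ <;> rw [e] at m1 m2
        · rw [← (h2 u m2).1, (h1 u m1).2, neg_one_mul]
        · rw [neg_one_mul, ← (h1 _ m1).1, (h2 _ m2).2, sub_neg_eq_add]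
    obtain ⟨σ, hσ, hγ⟩ := hsub
    have hσ2 : σ ^ 2 = 1 := by rcases hσ with rfl | rfl <;> norm_num
    have hσa : |σ| = 1 := by rcases hσ with rfl | rfl <;> norm_num
    refine ⟨a, b * σ - 2 * a * t, a * t ^ 2 - b * σ * t + c, ?_⟩
    filter_upwards [Metric.ball_mem_nhds t (lt_min hr hr')] with v hv
    rw [Metric.mem_ball, Real.dist_eq] at hv
    have h3 := hγ (v - t) hv
    rw [add_sub_cancel] at h3
    have h4 : |σ * (v - t)| < δ := by
      rw [abs_mul, hσa, one_mul]; exact (hv.trans_le (min_le_left _ _)).trans_le hrδ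
    simp only [F, h3]
    rw [hq _ (abs_lt.1 h4), mul_pow, hσ2]; ring
  have hana : AnalyticOnNhd ℝ F (Ioo 0 ρ) := by
    intro t ht
    obtain ⟨A, B, C, hABC⟩ := key t ht
    exact (by fun_prop : AnalyticAt ℝ (fun u : ℝ => C + B * u + A * u ^ 2) t).congr hABC.symm
  have hmid : ρ / 2 ∈ Ioo 0 ρ := ⟨by linarith, by linarith⟩
  obtain ⟨A, B, C, hABC⟩ := key _ hmid
  have hana' : AnalyticOnNhd ℝ (fun u : ℝ => C + B * u + A * u ^ 2) (Ioo 0 ρ) :=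
    fun t _ => by fun_prop
  exact ⟨A, B, C, fun t ht =>
    hana.eqOn_of_preconnected_of_eventuallyEq hana' isPreconnected_Ioo hmid hABC ht⟩

end Germ

/-! ### Arms as open intervals, and the length measure on them. -/

section ArmImage

variable {Γ : Type*} [MetricSpace Γ] [IsMetrizedGraph Γ] {x : Γ} {ρ : ℝ}

theorem isOpen_arm_image (k : Fin (valence x)) (hρ : ρ ≤ radius x) :
    IsOpen (arm x k '' Ioo 0 ρ) := by
  have h := image_arm_eq_ball k (t := ρ / 2) (δ := ρ / 2) le_rfl (by linarith)
  have : arm x k '' Ioo 0 ρ = Metric.ball (arm x k (ρ / 2)) (ρ / 2) := by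
    rw [← h]
    ext y
    simp only [mem_image, mem_Ioo]
    constructor
    · rintro ⟨t, ht, rfl⟩
      exact ⟨t - ρ / 2, ⟨by linarith [ht.1], by linarith [ht.2]⟩, by ring_nf⟩
    · rintro ⟨t, ht, rfl⟩
      exact ⟨ρ / 2 + t, ⟨by linarith [ht.1], by linarith [ht.2]⟩, rfl⟩
  rw [this]
  exact Metric.isOpen_ball

theorem isometry_arm (k : Fin (valence x)) (hρ : ρ ≤ radius x) :
    Isometry fun t : Ioo 0 ρ => arm x k t :=
  Isometry.of_dist_eq fun s t => by
    rw [dist_arm_same k s.2.1.le (s.2.2.trans_le hρ) t.2.1.le (t.2.2.trans_le hρ)]; rfl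

theorem range_arm (k : Fin (valence x)) (ρ : ℝ) :
    range (fun t : Ioo 0 ρ => arm x k t) = arm x k '' Ioo 0 ρ := by
  rw [image_eq_range]

theorem ball_eq_iUnion_arm (hρ0 : 0 < ρ) (hρ : ρ ≤ radius x) :
    Metric.ball x ρ = {x} ∪ ⋃ k, arm x k '' Ioo 0 ρ := by
  ext y
  simp only [Metric.mem_ball', mem_union, mem_singleton_iff, mem_iUnion, mem_image]
  constructor
  · intro hy
    rcases eq_or_ne x y with rfl | hne
    · exact Or.inl rfl
    · obtain ⟨k, hk⟩ := exists_arm (hy.trans_le hρ)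
      exact Or.inr ⟨k, _, ⟨dist_pos.2 hne, hy⟩, hk⟩
  · rintro (rfl | ⟨k, t, ht, rfl⟩)
    · simpa
    · rw [dist_arm k ht.1.le (ht.2.trans_le hρ)]; exact ht.2

theorem pairwise_disjoint_arm (hρ : ρ ≤ radius x) :
    Pairwise (Function.onFun Disjoint fun k => arm x k '' Ioo 0 ρ) := by
  intro k l hkl
  rw [Function.onFun, Set.disjoint_left]
  rintro _ ⟨s, hs, rfl⟩ ⟨t, ht, h⟩
  exact hkl (arm_injective hs.1 (hs.2.trans_le hρ) ht.1.le (ht.2.trans_le hρ) h.symm).1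

end ArmImage

section LengthMeasure

variable {Γ : Type*} [MetricSpace Γ] [MeasurableSpace Γ] [BorelSpace Γ] [IsMetrizedGraph Γ]

theorem measurableEmbedding_arm {x : Γ} (k : Fin (valence x)) {ρ : ℝ} (hρ : ρ ≤ radius x) :
    MeasurableEmbedding fun t : Ioo 0 ρ => arm x k t :=
  (isometry_arm k hρ).isEmbedding.measurableEmbedding
    (by rw [range_arm]; exact (isOpen_arm_image k hρ).measurableSet)

/-- Isometries preserve Hausdorff measure; this reduces integration over an arm to Lebesgue
integration over an interval. -/
theorem map_arm_hausdorffMeasure {x : Γ} (k : Fin (valence x)) {ρ : ℝ} (hρ : ρ ≤ radius x) :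
    Measure.map (fun t : Ioo 0 ρ => arm x k t) μH[1]
      = (μH[1] : Measure Γ).restrict (arm x k '' Ioo 0 ρ) := by
  rw [(isometry_arm k hρ).map_hausdorffMeasure (Or.inl zero_le_one), range_arm]

theorem map_val_hausdorffMeasure (s : Set ℝ) :
    Measure.map (Subtype.val : s → ℝ) μH[1] = volume.restrict s := by
  rw [isometry_subtype_coe.map_hausdorffMeasure (Or.inl zero_le_one), Subtype.range_coe,
    hausdorffMeasure_real]

variable {x : Γ} {ρ : ℝ} {φ : Γ → ℝ}

theorem setIntegral_arm (k : Fin (valence x)) (hρ : ρ ≤ radius x) (φ : Γ → ℝ) :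
    ∫ y in arm x k '' Ioo 0 ρ, φ y ∂μH[1] = ∫ t in Ioo 0 ρ, φ (arm x k t) := by
  rw [← map_arm_hausdorffMeasure k hρ, (measurableEmbedding_arm k hρ).integral_map,
    ← map_val_hausdorffMeasure,
    (MeasurableEmbedding.subtype_coe measurableSet_Ioo).integral_map]

theorem integrableOn_arm_iff (k : Fin (valence x)) (hρ : ρ ≤ radius x) :
    IntegrableOn φ (arm x k '' Ioo 0 ρ) μH[1]
      ↔ IntegrableOn (fun t => φ (arm x k t)) (Ioo 0 ρ) := by
  rw [IntegrableOn, IntegrableOn, ← map_arm_hausdorffMeasure k hρ,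
    (measurableEmbedding_arm k hρ).integrable_map_iff, ← map_val_hausdorffMeasure,
    (MeasurableEmbedding.subtype_coe measurableSet_Ioo).integrable_map_iff]
  rfl

instance : NullSingletonClass (μH[1] : Measure Γ) :=
  Measure.nullSingletonClass_hausdorff Γ one_pos

theorem ball_ae_eq_iUnion_arm (hρ0 : 0 < ρ) (hρ : ρ ≤ radius x) :
    Metric.ball x ρ =ᵐ[μH[1]] ⋃ k, arm x k '' Ioo 0 ρ := by
  rw [ball_eq_iUnion_arm hρ0 hρ]
  exact union_ae_eq_right_of_ae_eq_empty (ae_eq_empty.2 (measure_singleton x))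

theorem setIntegral_ball (hρ0 : 0 < ρ) (hρ : ρ ≤ radius x)
    (hφ : ∀ k, IntegrableOn (fun t => φ (arm x k t)) (Ioo 0 ρ)) :
    ∫ y in Metric.ball x ρ, φ y ∂μH[1] = ∑ k, ∫ t in Ioo 0 ρ, φ (arm x k t) := by
  rw [setIntegral_congr_set (ball_ae_eq_iUnion_arm hρ0 hρ), integral_iUnion_fintype
    (fun k => (isOpen_arm_image k hρ).measurableSet) (pairwise_disjoint_arm hρ)
    fun k => (integrableOn_arm_iff k hρ).2 (hφ k)]
  exact Finset.sum_congr rfl fun k _ => setIntegral_arm k hρ φ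

theorem integrableOn_ball (hρ0 : 0 < ρ) (hρ : ρ ≤ radius x)
    (hφ : ∀ k, IntegrableOn (fun t => φ (arm x k t)) (Ioo 0 ρ)) :
    IntegrableOn φ (Metric.ball x ρ) μH[1] := by
  rw [integrableOn_congr_set_ae (ball_ae_eq_iUnion_arm hρ0 hρ), integrableOn_finite_iUnion]
  exact fun k => (integrableOn_arm_iff k hρ).2 (hφ k)

/-- The integral of a function supported in a star is computed arm by arm. -/
theorem integral_eq_sum_arm (hρ0 : 0 < ρ) (hρ : ρ ≤ radius x)
    (hφ : ∀ k, IntegrableOn (fun t => φ (arm x k t)) (Ioo 0 ρ))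
    (h0 : ∀ y, ρ ≤ dist x y → φ y = 0) :
    ∫ y, φ y ∂μH[1] = ∑ k, ∫ t in Ioo 0 ρ, φ (arm x k t) := by
  rw [← setIntegral_ball hρ0 hρ hφ, setIntegral_eq_integral_of_forall_compl_eq_zero]
  intro y hy
  exact h0 y (by rwa [Metric.mem_ball', not_lt] at hy)

theorem integrable_of_arm
    (h : ∀ x : Γ, ∃ ρ > 0, ρ ≤ radius x ∧
      ∀ k, IntegrableOn (fun t => φ (arm x k t)) (Ioo 0 ρ)) : Integrable φ μH[1] := by
  choose ρ hρ hρR hφ using h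
  obtain ⟨s, hs⟩ := exists_finset_cover hρ
  rw [← integrableOn_univ]
  refine ((integrableOn_finset_iUnion (s := s) (t := fun x => Metric.ball x (ρ x))).2
    fun x _ => integrableOn_ball (hρ x) (hρR x) (hφ x)).mono_set fun y _ => ?_
  obtain ⟨x, hx, hxy⟩ := hs y
  exact mem_biUnion hx (Metric.mem_ball'.2 hxy)

/-- Each star has finitely many arms of finite length and finitely many stars cover Γ, so the
constant 1 is integrable. -/
instance : IsFiniteMeasure (μH[1] : Measure Γ) := by
  refine (integrable_const_iff_isFiniteMeasure (c := (1 : ℝ)) one_ne_zero).1 ?_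
  exact integrable_of_arm fun x => ⟨radius x, radius_pos x, le_rfl, fun k =>
    integrableOn_const (by simp)⟩

end LengthMeasure

/-! ### Integration against signed measures. -/

section SignedMeasureIntegral

variable {X : Type*} [MeasurableSpace X]

instance (μ : SignedMeasure X) : IsFiniteMeasure μ.variation := by
  rw [← SignedMeasure.totalVariation_eq_variation]; infer_instance

theorem integrable_variation_of_continuous [TopologicalSpace X] [CompactSpace X] [BorelSpace X]
    {f : X → ℝ} (hf : Continuous f) (μ : SignedMeasure X) : μ.Integrable f := by
  obtain ⟨C, hC⟩ := isCompact_univ.exists_bound_of_continuousOn hf.continuousOn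
  exact Integrable.of_bound hf.measurable.aestronglyMeasurable C
    (Eventually.of_forall fun x => hC x (mem_univ x))

theorem lsmul_flip_real :
    (ContinuousLinearMap.lsmul ℝ ℝ : ℝ →L[ℝ] ℝ →L[ℝ] ℝ)
      = (ContinuousLinearMap.lsmul ℝ ℝ : ℝ →L[ℝ] ℝ →L[ℝ] ℝ).flip := by
  ext; simp

/-- Split `w` into its positive and negative parts, apply the formula for positive densities to
each, and recombine by max(w, 0) − max(−w, 0) = w. -/
theorem integral_withDensityᵥ [TopologicalSpace X] [CompactSpace X] [BorelSpace X]
    {μ : Measure X} {f w : X → ℝ} (hf : Continuous f) (hw : Integrable w μ) :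
    ∫ᵛ x, f x ∂•(μ.withDensityᵥ w) = ∫ x, f x * w x ∂μ := by
  have h1 := isFiniteMeasure_withDensity_ofReal hw.2
  have h2 := isFiniteMeasure_withDensity_ofReal hw.neg.2
  obtain ⟨C, hC⟩ := isCompact_univ.exists_bound_of_continuousOn hf.continuousOn
  have hneg : AEMeasurable (fun x => -w x) μ := hw.neg.1.aemeasurable
  have hfw : ∀ v : X → ℝ, Integrable v μ → Integrable (fun x => (v x) • f x) μ := fun v hv => by
    simpa [mul_comm] using hv.bdd_mul hf.measurable.aestronglyMeasurable
      (Eventually.of_forall fun x => hC x (mem_univ x))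
  rw [withDensityᵥ_eq_withDensity_pos_part_sub_withDensity_neg_part hw,
    VectorMeasure.integral_sub_vectorMeasure (integrable_variation_of_continuous hf _)
      (integrable_variation_of_continuous hf _), lsmul_flip_real,
    VectorMeasure.integral_toSignedMeasure]
  erw [VectorMeasure.integral_toSignedMeasure]
  rw [integral_withDensity_eq_integral_toReal_smul₀ hw.1.aemeasurable.ennreal_ofReal (by simp),
    integral_withDensity_eq_integral_toReal_smul₀ hneg.ennreal_ofReal (by simp),
    ← integral_sub (hfw _ ?_) (hfw _ ?_)]
  · refine integral_congr_ae (Eventually.of_forall fun x => ?_)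
    simp only [ENNReal.toReal_ofReal', smul_eq_mul]
    rw [← sub_mul, max_zero_sub_eq_self, mul_comm]
  · simpa [ENNReal.toReal_ofReal'] using hw.pos_part
  · simpa [ENNReal.toReal_ofReal'] using hw.neg_part

theorem integral_vectorMeasure_smul (f : X → ℝ) (c : ℝ) (μ : SignedMeasure X) :
    ∫ᵛ y, f y ∂•(c • μ) = c * ∫ᵛ y, f y ∂•μ :=
  VectorMeasure.integral_smul_vectorMeasure f c

theorem integral_function_mul (c : ℝ) (f : X → ℝ) (μ : SignedMeasure X) :
    ∫ᵛ y, c * f y ∂•μ = c * ∫ᵛ y, f y ∂•μ :=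
  VectorMeasure.integral_fun_smul μ _ c f

theorem integral_function_const (c : ℝ) (μ : SignedMeasure X) :
    ∫ᵛ _y, c ∂•μ = c * μ univ := by
  simp

theorem diracAt_univ (x : X) : diracAt x univ = 1 :=
  VectorMeasure.dirac_apply_of_mem MeasurableSet.univ (mem_univ x)

end SignedMeasureIntegral

/-! ### Linearity of slopes and second derivatives; the maximum principle. -/

section SlopeSum

variable {Γ : Type*} [MetricSpace Γ] [IsMetrizedGraph Γ] {f g : Γ → ℝ} {x : Γ}

theorem HasGerm.secondDeriv_arm {a b : Fin (valence x) → ℝ} {ρ : ℝ} (hρ : ρ ≤ radius x)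
    (h : ∀ k, ∀ t ∈ Ico 0 ρ, f (arm x k t) = f x + b k * t + a k * t ^ 2)
    (k : Fin (valence x)) {t : ℝ} (ht : t ∈ Ioo 0 ρ) :
    secondDeriv f (arm x k t) = 2 * a k ∧ slopeSum f (arm x k t) = 0 := by
  obtain ⟨a', b', hg, hs, ha, -⟩ := hasGerm_arm_of_quadratic (k := k) hρ
    (fun t ht => h k t ⟨ht.1.le, ht.2⟩) ht
  exact ⟨by rw [hg.secondDeriv_eq, ha], by rw [hg.slopeSum_eq, hs]⟩

theorem HasGerms.finite_support_slopeSum (h : HasGerms f) : (Function.support (slopeSum f)).Finite :=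
  finite_not_of_punctured (p := fun y => slopeSum f y = 0) fun x => by
    obtain ⟨a, b, hg⟩ := h x
    obtain ⟨ρ, hρ, hρR, hq⟩ := hg.exists_radius
    exact ⟨ρ, hρ, hρR, fun k t ht => (HasGerm.secondDeriv_arm hρR hq k ht).2⟩

theorem HasGerms.slopeSum_add (h : HasGerms f) (h' : HasGerms g) (x : Γ) :
    slopeSum (f + g) x = slopeSum f x + slopeSum g x := by
  obtain ⟨a, b, hg⟩ := h x
  obtain ⟨a', b', hg'⟩ := h' x
  rw [hg.slopeSum_eq, hg'.slopeSum_eq, (hg.add hg').slopeSum_eq, ← Finset.sum_add_distrib]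
  rfl

theorem HasGerms.slopeSum_smul (h : HasGerms f) (c : ℝ) (x : Γ) :
    slopeSum (c • f) x = c * slopeSum f x := by
  obtain ⟨a, b, hg⟩ := h x
  rw [hg.slopeSum_eq, (hg.smul c).slopeSum_eq, Finset.mul_sum]
  rfl

theorem HasGerms.secondDeriv_add (h : HasGerms f) (h' : HasGerms g) :
    secondDeriv (f + g) = secondDeriv f + secondDeriv g := by
  ext x
  obtain ⟨a, b, hg⟩ := h x
  obtain ⟨a', b', hg'⟩ := h' x
  rw [Pi.add_apply, hg.secondDeriv_eq, hg'.secondDeriv_eq, (hg.add hg').secondDeriv_eq,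
    Pi.add_apply, mul_add]

theorem HasGerms.secondDeriv_smul (h : HasGerms f) (c : ℝ) :
    secondDeriv (c • f) = c • secondDeriv f := by
  ext x
  obtain ⟨a, b, hg⟩ := h x
  rw [Pi.smul_apply, hg.secondDeriv_eq, (hg.smul c).secondDeriv_eq, Pi.smul_apply, smul_eq_mul,
    smul_eq_mul, mul_left_comm]

theorem HasLinearGerms.secondDeriv_eq (h : HasLinearGerms f) : secondDeriv f = 0 := by
  ext x
  obtain ⟨b, hb⟩ := h x
  simp [hb.secondDeriv_eq]

theorem HasGerms.finite_support_smul_diracAt [MeasurableSpace Γ]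
    (h : HasGerms f) :
    (Function.support fun x => slopeSum f x • diracAt x).Finite :=
  h.finite_support_slopeSum.subset fun x hx h0 => hx (by simp [h0])

/-- **Maximum principle**: a function with linear germs all of whose slope sums vanish is
constant. -/
theorem eq_of_slopeSum_eq_zero (h : ∀ x, ∃ b, HasGerm f x 0 b ∧ ∑ k, b k = 0) (x y : Γ) :
    f x = f y := by
  have hlin : HasLinearGerms f := fun x => let ⟨b, hb, _⟩ := h x; ⟨b, hb⟩
  have hc := hlin.hasGerms.continuous
  obtain ⟨m, hm⟩ := hc.exists_forall_ge_of_hasCompactSupport (HasCompactSupport.of_compactSpace f)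
  have hclosed : IsClosed {z | f z = f m} := isClosed_eq hc continuous_const
  have hopen : IsOpen {z | f z = f m} := by
    rw [Metric.isOpen_iff]
    intro z hz
    obtain ⟨b, hb, hs⟩ := h z
    obtain ⟨ρ, hρ, hρR, hq⟩ := hb.exists_radius
    -- At a maximum every outgoing slope is nonpositive; as they sum to zero, all vanish. The linear
    -- germ is then constant, so the set of maxima is open as well as closed.
    have hle : ∀ k ∈ Finset.univ, b k ≤ 0 := by
      intro k _
      have h1 := hm (arm z k (ρ / 2))
      rw [hq k (ρ / 2) ⟨by linarith, by linarith⟩, ← show f z = f m from hz] at h1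
      simp only [Pi.zero_apply, zero_mul, add_zero] at h1
      nlinarith
    have hb0 := (Finset.sum_eq_zero_iff_of_nonpos hle).1 hs
    refine ⟨ρ, hρ, fun y hy => ?_⟩
    rw [Metric.mem_ball'] at hy
    obtain ⟨k, hk⟩ := exists_arm (hy.trans_le hρR)
    rw [mem_ofPred_eq, ← hk, hq k _ ⟨dist_nonneg, hy⟩, hb0 k (Finset.mem_univ k),
      ← show f z = f m from hz]
    simp
  have huniv : {z | f z = f m} = univ := IsClopen.eq_univ ⟨hclosed, hopen⟩ ⟨m, rfl⟩
  have hx : x ∈ {z | f z = f m} := huniv ▸ mem_univ x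
  have hy : y ∈ {z | f z = f m} := huniv ▸ mem_univ y
  exact Eq.trans hx (Eq.symm hy)

end SlopeSum

/-! ### The Laplacian as a signed measure, and uniqueness of potentials. -/

section Laplacian

variable {Γ : Type*} [MetricSpace Γ] [MeasurableSpace Γ] [BorelSpace Γ] [IsMetrizedGraph Γ]
  {f g : Γ → ℝ} {x : Γ}

theorem HasGerms.integrable_secondDeriv (h : HasGerms f) : Integrable (secondDeriv f) μH[1] := by
  refine integrable_of_arm fun x => ?_
  obtain ⟨a, b, hg⟩ := h x
  obtain ⟨ρ, hρ, hρR, hq⟩ := hg.exists_radius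
  refine ⟨ρ, hρ, hρR, fun k => ?_⟩
  refine (integrableOn_const (C := 2 * a k) (by simp)).congr_fun (fun t ht => ?_) measurableSet_Ioo
  exact (HasGerm.secondDeriv_arm hρR hq k ht).1.symm

theorem laplacian_add (hf : HasGerms f) (hg : HasGerms g) :
    laplacian (f + g) = laplacian f + laplacian g := by
  simp only [laplacian, hf.secondDeriv_add hg, hf.slopeSum_add hg, add_smul]
  rw [withDensityᵥ_add hf.integrable_secondDeriv hg.integrable_secondDeriv,
    finsum_add_distrib hf.finite_support_smul_diracAt hg.finite_support_smul_diracAt]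
  abel

theorem laplacian_smul (hf : HasGerms f) (c : ℝ) : laplacian (c • f) = c • laplacian f := by
  simp only [laplacian, hf.secondDeriv_smul, hf.slopeSum_smul, mul_smul]
  rw [withDensityᵥ_smul, smul_sub, smul_neg]
  congr 1
  rw [smul_finsum' _ hf.finite_support_smul_diracAt]

theorem laplacian_sub (hf : HasGerms f) (hg : HasGerms g) :
    laplacian (f - g) = laplacian f - laplacian g := by
  have := laplacian_add hf (hg.smul (-1))
  rw [laplacian_smul hg] at this
  rw [show f - g = f + (-1 : ℝ) • g by module, this]
  module

theorem laplacian_eq_sum {s : Finset Γ} (hs : ∀ x ∉ s, slopeSum f x = 0) :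
    laplacian f = -(μH[1] : Measure Γ).withDensityᵥ (secondDeriv f)
      - ∑ x ∈ s, slopeSum f x • diracAt x := by
  rw [laplacian, finsum_eq_sum_of_support_subset]
  intro x hx
  by_contra h
  exact hx (by simp [hs x h])

theorem HasLinearGerms.laplacian_eq_sum (hf : HasLinearGerms f) {s : Finset Γ}
    (hs : ∀ x ∉ s, slopeSum f x = 0) : laplacian f = - ∑ x ∈ s, slopeSum f x • diracAt x := by
  rw [MetrizedGraph.laplacian_eq_sum hs, hf.secondDeriv_eq, withDensityᵥ_zero, neg_zero,
    zero_sub]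

theorem laplacian_const (c : ℝ) : laplacian (fun _ : Γ => c) = 0 := by
  rw [HasLinearGerms.laplacian_eq_sum (s := ∅) (fun x => ⟨0, hasGerm_const c x⟩)
    fun x _ => by simp [(hasGerm_const c x).slopeSum_eq], Finset.sum_empty, neg_zero]

theorem laplacian_apply_of_slopeSum_eq_zero (hf : HasGerms f) {A : Set Γ} (hA : MeasurableSet A)
    (h : ∀ x ∈ A, slopeSum f x = 0) : laplacian f A = -∫ x in A, secondDeriv f x ∂μH[1] := by
  rw [laplacian_eq_sum (s := hf.finite_support_slopeSum.toFinset) (by simp)]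
  simp only [_root_.sub_apply, _root_.neg_apply, withDensityᵥ_apply hf.integrable_secondDeriv hA]
  rw [_root_.sum_apply, Finset.sum_eq_zero, sub_zero]
  intro x _
  by_cases hx : x ∈ A
  · simp [h x hx]
  · simp [diracAt, VectorMeasure.dirac_apply_of_notMem hx]

theorem laplacian_singleton (hf : HasGerms f) (x : Γ) : laplacian f {x} = -slopeSum f x := by
  classical
  rw [laplacian_eq_sum (s := insert x hf.finite_support_slopeSum.toFinset) (by simp)]
  simp only [_root_.sub_apply, _root_.neg_apply,
    withDensityᵥ_apply hf.integrable_secondDeriv (measurableSet_singleton x)]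
  rw [_root_.sum_apply, Finset.sum_eq_single x]
  · simp [diracAt]
  · intro y _ hyx
    simp [diracAt, VectorMeasure.dirac_apply_of_notMem (show y ∉ ({x} : Set Γ) from hyx)]
  · simp

/-- A function whose Laplacian is concentrated on a finite set has linear germs. -/
theorem hasGerm_of_laplacian (hf : HasGerms f) {s : Set Γ} (hs : s.Finite)
    (h : ∀ A, MeasurableSet A → Disjoint A s → laplacian f A = 0) (x : Γ) :
    ∃ b, HasGerm f x 0 b ∧ ∑ k, b k = -laplacian f {x} := by
  obtain ⟨a, b, hg⟩ := hf x
  obtain ⟨ρ, hρ, hρR, hq⟩ := hg.exists_radius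
  -- On an arm with the finite set removed the Laplacian has mass −2 a_k ρ, because finite sets have
  -- length zero; this mass vanishes by hypothesis.
  have ha : a = 0 := by
    ext k
    have hm := (isOpen_arm_image k hρR).measurableSet
    have h1 := laplacian_apply_of_slopeSum_eq_zero hf (hm.diff hs.measurableSet) (by
      rintro _ ⟨⟨t, ht, rfl⟩, -⟩
      exact (HasGerm.secondDeriv_arm hρR hq k ht).2)
    rw [h _ (hm.diff hs.measurableSet) disjoint_sdiff_left] at h1
    have h2 : ∫ y in arm x k '' Ioo 0 ρ \ s, secondDeriv f y ∂μH[1] = 2 * a k * ρ := by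
      rw [setIntegral_congr_set (sdiff_null_ae_eq_self (hs.measure_zero _)), setIntegral_arm k hρR,
        setIntegral_congr_fun measurableSet_Ioo
          fun t ht => (HasGerm.secondDeriv_arm hρR hq k ht).1]
      simp [hρ.le, mul_comm]
    rw [h2] at h1
    have h3 : a k * ρ = 0 := by linarith
    simpa [hρ.ne'] using h3
  subst ha
  exact ⟨b, hg, by rw [laplacian_singleton hf, hg.slopeSum_eq, neg_neg]⟩

theorem eq_of_laplacian_eq_zero (hf : HasGerms f) (h : laplacian f = 0) (x y : Γ) : f x = f y :=
  eq_of_slopeSum_eq_zero (fun x => by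
    obtain ⟨b, hb, hs⟩ := hasGerm_of_laplacian hf finite_empty (by simp [h]) x
    exact ⟨b, hb, by simp [hs, h]⟩) x y

theorem sub_eq_of_laplacian_eq (hf : HasGerms f) (hg : HasGerms g) (h : laplacian f = laplacian g)
    (x y : Γ) : f x - g x = f y - g y :=
  eq_of_laplacian_eq_zero (hf.sub hg) (by rw [laplacian_sub hf hg, h, sub_self]) x y

theorem integral_vectorMeasure_add (hf : Continuous f) (μ ν : SignedMeasure Γ) :
    ∫ᵛ y, f y ∂•(μ + ν) = ∫ᵛ y, f y ∂•μ + ∫ᵛ y, f y ∂•ν :=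
  VectorMeasure.integral_add_vectorMeasure (integrable_variation_of_continuous hf μ)
    (integrable_variation_of_continuous hf ν)

theorem integral_vectorMeasure_sub (hf : Continuous f) (μ ν : SignedMeasure Γ) :
    ∫ᵛ y, f y ∂•(μ - ν) = ∫ᵛ y, f y ∂•μ - ∫ᵛ y, f y ∂•ν :=
  VectorMeasure.integral_sub_vectorMeasure (integrable_variation_of_continuous hf μ)
    (integrable_variation_of_continuous hf ν)

theorem integral_vectorMeasure_sum (hf : Continuous f) {ι : Type*} (s : Finset ι)
    (μ : ι → SignedMeasure Γ) : ∫ᵛ y, f y ∂•(∑ i ∈ s, μ i) = ∑ i ∈ s, ∫ᵛ y, f y ∂•(μ i) :=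
  VectorMeasure.integral_finsetSum_vectorMeasure fun i _ =>
    integrable_variation_of_continuous hf (μ i)

theorem integral_diracAt (f : Γ → ℝ) (x : Γ) : ∫ᵛ y, f y ∂•(diracAt x) = f x := by simp

theorem integral_function_add (hf : Continuous f) (hg : Continuous g) (μ : SignedMeasure Γ) :
    ∫ᵛ y, (f y + g y) ∂•μ = ∫ᵛ y, f y ∂•μ + ∫ᵛ y, g y ∂•μ :=
  VectorMeasure.integral_fun_add (integrable_variation_of_continuous hf μ)
    (integrable_variation_of_continuous hg μ)

theorem integral_function_sub (hf : Continuous f) (hg : Continuous g) (μ : SignedMeasure Γ) :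
    ∫ᵛ y, (f y - g y) ∂•μ = ∫ᵛ y, f y ∂•μ - ∫ᵛ y, g y ∂•μ :=
  VectorMeasure.integral_fun_sub (integrable_variation_of_continuous hf μ)
    (integrable_variation_of_continuous hg μ)

theorem integral_laplacian (hf : Continuous f) (hg : HasGerms g) {s : Finset Γ}
    (hs : ∀ x ∉ s, slopeSum g x = 0) :
    ∫ᵛ y, f y ∂•(laplacian g)
      = -(∫ y, f y * secondDeriv g y ∂μH[1]) - ∑ x ∈ s, f x * slopeSum g x := by
  rw [laplacian_eq_sum hs, integral_vectorMeasure_sub hf, VectorMeasure.integral_neg_vectorMeasure,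
    integral_withDensityᵥ hf hg.integrable_secondDeriv, integral_vectorMeasure_sum hf]
  congr 1
  exact Finset.sum_congr rfl fun x _ => by
    rw [integral_vectorMeasure_smul, integral_diracAt, mul_comm]

end Laplacian

/-! ### Tent functions and Green's formula for them. -/

section Tent

variable {Γ : Type*} [MetricSpace Γ] [IsMetrizedGraph Γ]

/-- The function which is `1` at `x` and decreases linearly to `0` over a length `a k` of the
arm `k`. -/
def tent (x : Γ) (a : Fin (valence x) → ℝ) (y : Γ) : ℝ :=
  open Classical in
  if h : dist x y < radius x then max 0 (1 - dist x y / a (exists_arm h).choose) else 0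

variable {x : Γ} {a : Fin (valence x) → ℝ}

/-- The arm chosen in the definition is unique away from the centre, and at the centre the value is
1 whichever arm is chosen. -/
theorem tent_arm (k : Fin (valence x)) {t : ℝ} (ht : 0 ≤ t) (ht' : t < radius x) :
    tent x a (arm x k t) = max 0 (1 - t / a k) := by
  have hd := dist_arm k ht ht'
  have h : dist x (arm x k t) < radius x := by rwa [hd]
  rw [tent, dif_pos h]
  have hs := (exists_arm h).choose_spec
  set l := (exists_arm h).choose
  rw [hd] at hs ⊢
  rcases eq_or_lt_of_le ht with rfl | h0
  · simp
  · rw [(arm_injective h0 ht' ht ht' hs).1]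

theorem tent_self : tent x a x = 1 := by
  have := tent_arm (a := a) (firstArm x) le_rfl (radius_pos x)
  simpa using this

theorem tent_nonneg (y : Γ) : 0 ≤ tent x a y := by
  rw [tent]; split_ifs
  · exact le_max_left _ _
  · exact le_rfl

theorem tent_le_one (ha : ∀ k, 0 < a k) (y : Γ) : tent x a y ≤ 1 := by
  rw [tent]; split_ifs
  · refine max_le zero_le_one ?_
    have := div_nonneg (dist_nonneg (x := x) (y := y)) (ha (exists_arm ‹_›).choose).le
    linarith
  · exact zero_le_one

theorem tent_eq_zero (ha : ∀ k, 0 < a k) {y : Γ} (h : ∀ k, a k ≤ dist x y) : tent x a y = 0 := by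
  rw [tent]; split_ifs with h'
  · have := h (exists_arm h').choose
    have h1 := (one_le_div (ha (exists_arm h').choose)).2 this
    exact max_eq_left (by linarith)
  · rfl

theorem eventually_dist_arm_lt (y : Γ) (k : Fin (valence y)) {δ : ℝ} (hδ : 0 < δ) :
    ∀ᶠ t in 𝓝[≥] (0 : ℝ), dist y (arm y k t) < δ := by
  filter_upwards [eventually_Ico (lt_min hδ (radius_pos y))] with t ht
  rw [dist_arm k ht.1 (ht.2.trans_le (min_le_right _ _))]
  exact ht.2.trans_le (min_le_left _ _)

theorem hasGerm_tent_self (ha : ∀ k, 0 < a k) (ha' : ∀ k, a k < radius x) :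
    HasGerm (tent x a) x 0 fun k => -(1 / a k) := fun k => by
  filter_upwards [eventually_Ico (ha k)] with t ht
  rw [tent_arm k ht.1 (ht.2.trans (ha' k)), tent_self]
  have := (div_lt_one (ha k)).2 ht.2
  rw [max_eq_right (by linarith)]
  simp; ring

/-- Before the tip the two directions have opposite slopes, beyond it both slopes vanish; at the tip
only the slope 1 / a_k back towards the centre survives. -/
theorem hasGerm_tent_arm (ha : ∀ k, 0 < a k) (k : Fin (valence x)) {t : ℝ} (ht : 0 < t)
    (ht' : t < radius x) :
    ∃ b, HasGerm (tent x a) (arm x k t) 0 b ∧ ∑ i, b i = if t = a k then 1 / a k else 0 := by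
  have hr : ∀ᶠ s in 𝓝[≥] (0 : ℝ),
      tent x a (arm x k (t + s)) = max 0 (1 - (t + s) / a k) := by
    filter_upwards [eventually_Ico (sub_pos.2 ht')] with s hs
    exact tent_arm k (by linarith [hs.1]) (by linarith [hs.2])
  have hl : ∀ᶠ s in 𝓝[≥] (0 : ℝ),
      tent x a (arm x k (t - s)) = max 0 (1 - (t - s) / a k) := by
    filter_upwards [eventually_Ico ht] with s hs
    exact tent_arm k (by linarith [hs.2]) (by linarith [hs.1])
  have hv := tent_arm (a := a) k ht.le ht'
  have hak := ha k
  suffices H : ∃ b₁ b₂ : ℝ, b₁ + b₂ = (if t = a k then 1 / a k else 0) ∧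
      (∀ᶠ s in 𝓝[≥] (0 : ℝ),
        max 0 (1 - (t + s) / a k) = max 0 (1 - t / a k) + b₁ * s + 0 * s ^ 2) ∧
      (∀ᶠ s in 𝓝[≥] (0 : ℝ),
        max 0 (1 - (t - s) / a k) = max 0 (1 - t / a k) + b₂ * s + 0 * s ^ 2) by
    obtain ⟨b₁, b₂, hb, h1, h2⟩ := H
    obtain ⟨a', b, hg, hs, hab⟩ := hasGerm_arm (f := tent x a) ht ht'
      (hr.congr (Eventually.of_forall fun s => Iff.rfl) |>.and h1 |>.mono fun s hs => by
        rw [hs.1, hs.2, hv])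
      (hl.and h2 |>.mono fun s hs => by rw [hs.1, hs.2, hv])
    have : a' = 0 := by ext i; rcases hab i with h | h <;> exact h.1
    exact ⟨b, this ▸ hg, by rw [hs, hb]⟩
  have hpos : ∀ u, u ≤ a k → max 0 (1 - u / a k) = 1 - u / a k := fun u hu =>
    max_eq_right (by linarith [(div_le_one hak).2 hu])
  have hneg : ∀ u, a k ≤ u → max 0 (1 - u / a k) = 0 := fun u hu =>
    max_eq_left (by linarith [(one_le_div hak).2 hu])
  rcases lt_trichotomy t (a k) with h | h | h
  · refine ⟨-(1 / a k), 1 / a k, by rw [if_neg h.ne]; ring, ?_, ?_⟩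
    · filter_upwards [eventually_Ico (sub_pos.2 h)] with s hs
      rw [hpos _ (by linarith [hs.2]), hpos _ h.le]; ring
    · filter_upwards [self_mem_nhdsWithin] with s hs
      rw [hpos _ (by linarith [mem_Ici.1 hs]), hpos _ h.le]; ring
  · refine ⟨0, 1 / a k, by rw [if_pos h, zero_add], ?_, ?_⟩
    · filter_upwards [self_mem_nhdsWithin] with s hs
      rw [hneg _ (by linarith [mem_Ici.1 hs]), hneg _ h.ge]; ring
    · filter_upwards [self_mem_nhdsWithin] with s hs
      rw [hpos _ (by linarith [mem_Ici.1 hs]), hneg _ h.ge, h]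
      field_simp; ring
  · refine ⟨0, 0, by rw [if_neg h.ne', zero_add], ?_, ?_⟩
    · filter_upwards [self_mem_nhdsWithin] with s hs
      rw [hneg _ (by linarith [mem_Ici.1 hs]), hneg _ h.le]; ring
    · filter_upwards [eventually_Ico (sub_pos.2 h)] with s hs
      rw [hneg _ (by linarith [hs.2]), hneg _ h.le]; ring

theorem hasGerm_tent_of_lt (ha : ∀ k, 0 < a k) {y : Γ} (h : ∀ k, a k < dist x y) :
    HasGerm (tent x a) y 0 0 := fun l => by
  have : ∀ᶠ t in 𝓝[≥] (0 : ℝ), ∀ k, dist y (arm y l t) < dist x y - a k :=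
    eventually_all.2 fun k => eventually_dist_arm_lt y l (sub_pos.2 (h k))
  filter_upwards [this] with t ht
  rw [tent_eq_zero ha fun k => (h k).le, tent_eq_zero ha fun k => ?_]
  · simp
  · have := dist_triangle x (arm y l t) y
    rw [dist_comm (arm y l t) y] at this
    linarith [ht k]

theorem exists_hasGerm_tent (ha : ∀ k, 0 < a k) (ha' : ∀ k, a k < radius x) (y : Γ) :
    ∃ b, HasGerm (tent x a) y 0 b ∧ (y ≠ x → (∀ k, y ≠ arm x k (a k)) → ∑ i, b i = 0) := by
  by_cases hy : dist x y < radius x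
  · obtain ⟨k, t, ht, ht', rfl⟩ : ∃ k t, 0 ≤ t ∧ t < radius x ∧ arm x k t = y :=
      let ⟨k, hk⟩ := exists_arm hy; ⟨k, _, dist_nonneg, hy, hk⟩
    rcases eq_or_lt_of_le ht with rfl | h0
    · rw [arm_zero]
      exact ⟨_, hasGerm_tent_self ha ha', fun h => absurd rfl h⟩
    · obtain ⟨b, hb, hs⟩ := hasGerm_tent_arm ha k h0 ht'
      refine ⟨b, hb, fun _ h => ?_⟩
      rw [hs, if_neg]
      rintro rfl
      exact h k rfl
  · exact ⟨0, hasGerm_tent_of_lt ha fun k => (ha' k).trans_le (not_lt.1 hy), by simp⟩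

theorem hasLinearGerms_tent (ha : ∀ k, 0 < a k) (ha' : ∀ k, a k < radius x) :
    HasLinearGerms (tent x a) := fun y =>
  let ⟨b, hb, _⟩ := exists_hasGerm_tent ha ha' y; ⟨b, hb⟩

end Tent

section TentLaplacian

variable {Γ : Type*} [MetricSpace Γ] [MeasurableSpace Γ] [BorelSpace Γ] [IsMetrizedGraph Γ]
  {x : Γ} {a : Fin (valence x) → ℝ}

/-- Tents are piecewise linear, so only the atoms at the centre and at the tips remain. Pairing with
this measure produces the sum of difference quotients at `x`, with a freely chosen step on each arm.
-/
theorem laplacian_tent (ha : ∀ k, 0 < a k) (ha' : ∀ k, a k < radius x) :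
    laplacian (tent x a) = ∑ k, (1 / a k) • (diracAt x - diracAt (arm x k (a k))) := by
  classical
  have hinj : Function.Injective fun k => arm x k (a k) := fun k l h =>
    (arm_injective (ha k) (ha' k) (ha l).le (ha' l) h).1
  have hx : x ∉ Finset.univ.image fun k => arm x k (a k) := by
    simp only [Finset.mem_image, Finset.mem_univ, true_and, not_exists]
    intro k hk
    have := dist_arm k (ha k).le (ha' k)
    rw [hk, dist_self] at this
    exact (ha k).ne this
  rw [(hasLinearGerms_tent ha ha').laplacian_eq_sum
    (s := insert x (Finset.univ.image fun k => arm x k (a k))), Finset.sum_insert hx,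
    Finset.sum_image hinj.injOn, (hasGerm_tent_self ha ha').slopeSum_eq]
  · have : ∀ k, slopeSum (tent x a) (arm x k (a k)) = 1 / a k := fun k => by
      obtain ⟨b, hb, hs⟩ := hasGerm_tent_arm ha k (ha k) (ha' k)
      rw [hb.slopeSum_eq, hs, if_pos rfl]
    have hsum : (∑ k, 1 / a k) • diracAt x = ∑ k, (1 / a k) • diracAt x := Finset.sum_smul
    simp only [this, Finset.sum_neg_distrib, smul_sub, Finset.sum_sub_distrib, ← hsum]
    module
  · intro y hy
    simp only [Finset.mem_insert, Finset.mem_image, Finset.mem_univ, true_and, not_or,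
      not_exists] at hy
    obtain ⟨b, hb, hs⟩ := exists_hasGerm_tent ha ha' y
    rw [hb.slopeSum_eq, hs hy.1 fun k hk => hy.2 k hk.symm]

theorem integral_max_zero_one_sub {c ρ : ℝ} (hc : 0 < c) (hcρ : c < ρ) :
    ∫ t in Ioo 0 ρ, max 0 (1 - t / c) = c / 2 := by
  have hcont : Continuous fun t : ℝ => max 0 (1 - t / c) := by fun_prop
  rw [← integral_Ioc_eq_integral_Ioo, ← intervalIntegral.integral_of_le (hc.trans hcρ).le,
    ← intervalIntegral.integral_add_adjacent_intervals (b := c) (hcont.intervalIntegrable _ _)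
      (hcont.intervalIntegrable _ _),
    intervalIntegral.integral_congr (g := fun t => 1 - t / c) (a := 0) (b := c),
    intervalIntegral.integral_congr (g := fun _ => (0 : ℝ)) (a := c) (b := ρ)]
  · simp only [intervalIntegral.integral_zero, add_zero]
    rw [intervalIntegral.integral_sub (by simp) ((by fun_prop : Continuous fun t : ℝ => t / c).intervalIntegrable _ _)]
    simp; field_simp; norm_num
  · intro t ht
    rw [uIcc_of_le hcρ.le] at ht
    exact max_eq_left (by linarith [(one_le_div hc).2 ht.1])
  · intro t ht
    rw [uIcc_of_le hc.le] at ht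
    exact max_eq_right (by linarith [(div_le_one hc).2 ht.2])

theorem integral_laplacian_tent {g : Γ → ℝ} (hg : Continuous g) (ha : ∀ k, 0 < a k)
    (ha' : ∀ k, a k < radius x) :
    ∫ᵛ y, g y ∂•(laplacian (tent x a)) = ∑ k, (1 / a k) * (g x - g (arm x k (a k))) := by
  rw [laplacian_tent ha ha', integral_vectorMeasure_sum hg]
  refine Finset.sum_congr rfl fun k _ => ?_
  rw [integral_vectorMeasure_smul, integral_vectorMeasure_sub hg, integral_diracAt, integral_diracAt]

/-- Green's formula for a tent supported in a star on the arms of which `g` is quadratic. -/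
theorem integral_tent_laplacian {g : Γ → ℝ} (hg : HasGerms g) {A B : Fin (valence x) → ℝ} {ρ : ℝ}
    (hρ : 0 < ρ) (hρR : ρ ≤ radius x)
    (hq : ∀ k, ∀ t ∈ Ico 0 ρ, g (arm x k t) = g x + B k * t + A k * t ^ 2)
    (ha : ∀ k, 0 < a k) (ha' : ∀ k, a k < ρ) :
    ∫ᵛ y, tent x a y ∂•(laplacian g) = ∫ᵛ y, g y ∂•(laplacian (tent x a)) := by
  classical
  have haR : ∀ k, a k < radius x := fun k => (ha' k).trans_le hρR
  have hfar : ∀ y, ρ ≤ dist x y → tent x a y = 0 := fun y hy =>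
    tent_eq_zero ha fun k => (ha' k).le.trans hy
  rw [integral_laplacian_tent hg.continuous ha haR,
    integral_laplacian (hasLinearGerms_tent ha haR).hasGerms.continuous hg
      (s := insert x hg.finite_support_slopeSum.toFinset) (by simp),
    Finset.sum_eq_single x]
  · have hgx : HasGerm g x A B := fun k => by
      filter_upwards [eventually_Ico hρ] with t ht using hq k t ht
    have heq : ∀ k, EqOn (fun t => max 0 (1 - t / a k) * (2 * A k))
        (fun t => tent x a (arm x k t) * secondDeriv g (arm x k t)) (Ioo 0 ρ) := fun k t ht => by
      simp only
      rw [tent_arm k ht.1.le (ht.2.trans_le hρR), (HasGerm.secondDeriv_arm hρR hq k ht).1]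
    rw [integral_eq_sum_arm (x := x) hρ hρR]
    · rw [tent_self, hgx.slopeSum_eq, one_mul, ← Finset.sum_neg_distrib, ← Finset.sum_sub_distrib]
      refine Finset.sum_congr rfl fun k _ => ?_
      -- The triangle under the tent has area a_k / 2, so both sides contribute −(B_k + A_k a_k) on
      -- arm `k`.
      rw [← setIntegral_congr_fun measurableSet_Ioo (heq k), integral_mul_const,
        integral_max_zero_one_sub (ha k) (ha' k), hq k (a k) ⟨(ha k).le, ha' k⟩]
      have := (ha k).ne'
      field_simp
      ring
    · intro k
      refine IntegrableOn.congr_fun ?_ (heq k) measurableSet_Ioo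
      exact ((by fun_prop : Continuous fun t : ℝ => max 0 (1 - t / a k) * (2 * A k)).integrableOn_Icc
        (a := 0) (b := ρ)).mono_set Ioo_subset_Icc_self
    · intro y hy
      rw [hfar y hy, zero_mul]
  · intro y _ hne
    by_cases hy : dist x y < ρ
    · obtain ⟨k, hk⟩ := exists_arm (hy.trans_le hρR)
      rw [← hk, (HasGerm.secondDeriv_arm hρR hq k ⟨dist_pos.2 hne.symm, hy⟩).2, mul_zero]
    · rw [hfar y (not_lt.1 hy), zero_mul]
  · simp

end TentLaplacian

/-! ### Existence of potentials by duality. -/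

section Potential

variable {Γ : Type*} [MetricSpace Γ] [MeasurableSpace Γ] [BorelSpace Γ] [IsMetrizedGraph Γ]

/-- The Laplacians of the functions which satisfy Green's formula with `g`. -/
def greenSubmodule (g : Γ → ℝ) (hg : Continuous g) : Submodule ℝ (SignedMeasure Γ) where
  carrier := {μ | ∃ v, HasGerms v ∧ laplacian v = μ ∧
    ∫ᵛ y, v y ∂•(laplacian g) = ∫ᵛ y, g y ∂•μ}
  add_mem' := by
    rintro _ _ ⟨v, hv, rfl, h⟩ ⟨w, hw, rfl, h'⟩
    refine ⟨v + w, hv.add hw, laplacian_add hv hw, ?_⟩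
    rw [integral_vectorMeasure_add hg, ← h, ← h']
    exact integral_function_add hv.continuous hw.continuous _
  zero_mem' := ⟨fun _ => 0, hasGerms_const 0, laplacian_const 0, by simp⟩
  smul_mem' := by
    rintro c _ ⟨v, hv, rfl, h⟩
    refine ⟨c • v, hv.smul c, laplacian_smul hv c, ?_⟩
    rw [integral_vectorMeasure_smul, ← h]
    exact integral_function_mul c v _

/-- Otherwise some linear functional `l` kills the submodule but not δ_x − δ_y. The submodule
contains the Laplacians of all small tents, so z ↦ l(δ_z) is harmonic and hence constant, a
contradiction. No continuity of `l` is needed, since linearity of the germs comes out of the tent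
relations. -/
theorem diracAt_sub_mem_greenSubmodule {g : Γ → ℝ} (hg : HasGerms g) (x y : Γ) :
    diracAt x - diracAt y ∈ greenSubmodule g hg.continuous := by
  classical
  by_contra hnot
  obtain ⟨l, hl, hker⟩ := Submodule.exists_le_ker_of_notMem hnot
  apply hl
  rw [map_sub, sub_eq_zero]
  refine eq_of_slopeSum_eq_zero (f := fun z => l (diracAt z)) (fun z => ?_) x y
  obtain ⟨A, B, hgz⟩ := hg z
  obtain ⟨ρ, hρ, hρR, hq⟩ := hgz.exists_radius
  set h : Γ → ℝ := fun z => l (diracAt z)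
  have key : ∀ a : Fin (valence z) → ℝ, (∀ k, 0 < a k) → (∀ k, a k < ρ) →
      ∑ k, (1 / a k) * (h z - h (arm z k (a k))) = 0 := by
    intro a ha ha'
    have haR : ∀ k, a k < radius z := fun k => (ha' k).trans_le hρR
    have := hker (show laplacian (tent z a) ∈ greenSubmodule g hg.continuous from
      ⟨tent z a, (hasLinearGerms_tent ha haR).hasGerms, rfl,
        integral_tent_laplacian hg hρ hρR hq ha ha'⟩)
    rw [LinearMap.mem_ker, laplacian_tent ha haR, map_sum] at this
    rw [← this]
    refine Finset.sum_congr rfl fun k _ => ?_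
    rw [map_smul, map_sub, smul_eq_mul]
  have hhalf : 0 < ρ / 2 := by linarith
  have hhalf' : ρ / 2 < ρ := by linarith
  have key0 := key (fun _ => ρ / 2) (fun _ => hhalf) (fun _ => hhalf')
  refine ⟨fun k => (1 / (ρ / 2)) * (h (arm z k (ρ / 2)) - h z), fun k => ?_, ?_⟩
  · filter_upwards [eventually_Ico hρ] with t ht
    rcases eq_or_lt_of_le ht.1 with rfl | h0
    · simp
    -- Changing the tent length on one arm only and comparing with equal lengths ρ/2 shows that the
    -- difference quotient of `h` on that arm is independent of the step, so `h` is linear there.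
    -- The relation with equal lengths then says that the slopes sum to zero.
    have key1 := key (Function.update (fun _ => ρ / 2) k t)
      (fun l => by rcases eq_or_ne l k with rfl | hne <;> simp [*])
      (fun l => by rcases eq_or_ne l k with rfl | hne <;> simp [*, ht.2])
    have := Finset.sum_sub_distrib (s := Finset.univ)
      (f := fun l => (1 / (Function.update (fun _ => ρ / 2) k t) l) *
        (h z - h (arm z l ((Function.update (fun _ => ρ / 2) k t : _ → ℝ) l))))
      (g := fun l => (1 / (ρ / 2)) * (h z - h (arm z l (ρ / 2))))
    rw [key1, key0, Finset.sum_eq_single k (fun l _ hne => by simp [hne]) (by simp)] at this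
    simp only [Function.update_self, sub_zero] at this
    simp only [Pi.zero_apply, zero_mul, add_zero]
    field_simp at this ⊢
    linarith
  · rw [← neg_eq_zero, ← Finset.sum_neg_distrib, ← key0]
    exact Finset.sum_congr rfl fun k _ => by ring

/-- Existence of potentials, together with Green's formula. -/
theorem exists_potential {g : Γ → ℝ} (hg : HasGerms g) (x y : Γ) :
    ∃ v, HasGerms v ∧ laplacian v = diracAt x - diracAt y ∧
      ∫ᵛ z, v z ∂•(laplacian g) = g x - g y := by
  obtain ⟨v, hv, hΔ, h⟩ := diracAt_sub_mem_greenSubmodule hg x y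
  refine ⟨v, hv, hΔ, ?_⟩
  rw [h, integral_vectorMeasure_sub hg.continuous, integral_diracAt, integral_diracAt]

end Potential

/-! ### A class of functions stable under quotients, and integration by parts. -/

section Slope

variable {Γ : Type*} [MetricSpace Γ] [IsMetrizedGraph Γ]

/-- The outgoing slope of `f` at `y` along the arm `l`. -/
def slope (f : Γ → ℝ) (y : Γ) (l : Fin (valence y)) : ℝ :=
  derivWithin (fun t => f (arm y l t)) (Ici 0) 0

theorem slopeSum_eq_sum_slope (f : Γ → ℝ) (y : Γ) : slopeSum f y = ∑ l, slope f y l := rfl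

theorem HasGerm.slope_eq {f : Γ → ℝ} {y : Γ} {a b : Fin (valence y) → ℝ} (h : HasGerm f y a b)
    (l : Fin (valence y)) : slope f y l = b l :=
  (h.hasDerivWithinAt l).derivWithin (uniqueDiffWithinAt_Ici 0)

theorem HasGerms.exists_slope_le {f : Γ → ℝ} (h : HasGerms f) :
    ∃ C, ∀ y l, |slope f y l| ≤ C := by
  choose a b hg using h
  choose ρ hρ hρR hq using fun x => (hg x).exists_radius
  obtain ⟨s, hs⟩ := exists_finset_cover hρ
  have hnn : ∀ x : Γ, ∀ k, 0 ≤ |b x k| + 2 * |a x k| * ρ x := fun x k => by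
    have := (hρ x).le
    positivity
  refine ⟨∑ x ∈ s, ∑ k, (|b x k| + 2 * |a x k| * ρ x), fun y l => ?_⟩
  obtain ⟨x, hx, hxy⟩ := hs y
  refine le_trans ?_ (Finset.single_le_sum (f := fun x => ∑ k, (|b x k| + 2 * |a x k| * ρ x))
    (fun x _ => Finset.sum_nonneg fun k _ => hnn x k) hx)
  have hle : ∀ k, |b x k| + 2 * |a x k| * ρ x ≤ ∑ k, (|b x k| + 2 * |a x k| * ρ x) := fun k =>
    Finset.single_le_sum (f := fun k => |b x k| + 2 * |a x k| * ρ x) (fun k _ => hnn x k)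
      (Finset.mem_univ k)
  obtain ⟨k, t, ht, ht', rfl⟩ : ∃ k t, 0 ≤ t ∧ t < ρ x ∧ arm x k t = y :=
    let ⟨k, hk⟩ := exists_arm (hxy.trans_le (hρR x)); ⟨k, _, dist_nonneg, hxy, hk⟩
  rcases eq_or_lt_of_le ht with h0 | h0
  · have hy : arm x k t = x := by rw [← h0, arm_zero]
    revert l
    rw [hy]
    intro l
    rw [(hg x).slope_eq]
    refine le_trans ?_ (hle l)
    have := mul_nonneg (mul_nonneg zero_le_two (abs_nonneg (a x l))) (hρ x).le
    linarith
  · obtain ⟨a', b', hg', -, -, hb'⟩ := hasGerm_arm_of_quadratic (k := k) (hρR x)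
      (fun t ht => hq x k t ⟨ht.1.le, ht.2⟩) ⟨h0, ht'⟩
    rw [hg'.slope_eq, hb']
    refine le_trans ?_ (hle k)
    calc |b x k + 2 * a x k * t| ≤ |b x k| + |2 * a x k * t| := abs_add_le _ _
      _ ≤ |b x k| + 2 * |a x k| * ρ x := by
        rw [abs_mul, abs_mul, abs_two, abs_of_nonneg ht]; gcongr

/-- Continuous functions with bounded one-sided slopes, which are differentiable off a finite set.
-/
structure PiecewiseSmooth (f : Γ → ℝ) : Prop where
  continuous : Continuous f
  differentiable : ∀ y l, DifferentiableWithinAt ℝ (fun t => f (arm y l t)) (Ici 0) 0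
  finite_support : (Function.support (slopeSum f)).Finite
  exists_bound : ∃ C, ∀ y l, |slope f y l| ≤ C

theorem HasGerms.piecewiseSmooth {f : Γ → ℝ} (h : HasGerms f) : PiecewiseSmooth f where
  continuous := h.continuous
  differentiable y l :=
    let ⟨_, _, hg⟩ := h y; (hg.hasDerivWithinAt l).differentiableWithinAt
  finite_support := h.finite_support_slopeSum
  exists_bound := h.exists_slope_le

variable {f g : Γ → ℝ}

theorem PiecewiseSmooth.slope_div (hf : PiecewiseSmooth f) (hg : PiecewiseSmooth g)
    (h0 : ∀ y, 0 < g y) (y : Γ) (l : Fin (valence y)) :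
    HasDerivWithinAt (fun t => f (arm y l t) / g (arm y l t))
      ((slope f y l * g y - f y * slope g y l) / g y ^ 2) (Ici 0) 0 := by
  have := (hf.differentiable y l).hasDerivWithinAt.div (hg.differentiable y l).hasDerivWithinAt
    (h0 _).ne'
  simp only [arm_zero] at this
  exact this

theorem PiecewiseSmooth.slope_div_eq (hf : PiecewiseSmooth f) (hg : PiecewiseSmooth g)
    (h0 : ∀ y, 0 < g y) (y : Γ) (l : Fin (valence y)) :
    slope (fun z => f z / g z) y l = (slope f y l * g y - f y * slope g y l) / g y ^ 2 :=
  (hf.slope_div hg h0 y l).derivWithin (uniqueDiffWithinAt_Ici 0)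

/-- A partition of unity made from tents involves quotients, which are no longer piecewise
quadratic. By the quotient rule, the slope sum of f / g vanishes wherever those of `f` and `g` both
do. -/
theorem PiecewiseSmooth.div (hf : PiecewiseSmooth f) (hg : PiecewiseSmooth g)
    (h0 : ∀ y, 0 < g y) : PiecewiseSmooth fun z => f z / g z where
  continuous := hf.continuous.div hg.continuous fun y => (h0 y).ne'
  differentiable y l := (hf.slope_div hg h0 y l).differentiableWithinAt
  finite_support := by
    refine (hf.finite_support.union hg.finite_support).subset fun y hy => ?_
    by_contra hcon
    simp only [mem_union, Function.mem_support, not_or, not_not] at hcon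
    apply hy
    simp only [slopeSum_eq_sum_slope] at hcon ⊢
    simp only [hf.slope_div_eq hg h0]
    rw [← Finset.sum_div, Finset.sum_sub_distrib, ← Finset.sum_mul, ← Finset.mul_sum, hcon.1,
      hcon.2]
    simp
  exists_bound := by
    obtain ⟨C, hC⟩ := hf.exists_bound
    obtain ⟨C', hC'⟩ := hg.exists_bound
    obtain ⟨M, hM⟩ := isCompact_univ.exists_bound_of_continuousOn hf.continuous.continuousOn
    obtain ⟨M', hM'⟩ := isCompact_univ.exists_bound_of_continuousOn hg.continuous.continuousOn
    obtain ⟨N, hN⟩ := isCompact_univ.exists_bound_of_continuousOn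
      ((hg.continuous.pow 2).inv₀ fun y => (pow_pos (h0 y) 2).ne').continuousOn
    refine ⟨(C * M' + M * C') * N, fun y l => ?_⟩
    have h1 := hC y l
    have h2 := hC' y l
    have h3 := hM y (mem_univ y)
    have h4 := hM' y (mem_univ y)
    have h5 := hN y (mem_univ y)
    rw [Real.norm_eq_abs] at h3 h4 h5
    rw [hf.slope_div_eq hg h0, div_eq_mul_inv, abs_mul]
    have : |slope f y l * g y - f y * slope g y l| ≤ C * M' + M * C' :=
      (abs_sub _ _).trans (by
        rw [abs_mul, abs_mul]
        exact add_le_add (mul_le_mul h1 h4 (abs_nonneg _) ((abs_nonneg _).trans h1))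
          (mul_le_mul h3 h2 (abs_nonneg _) ((abs_nonneg _).trans h3)))
    exact mul_le_mul this h5 (abs_nonneg _) ((abs_nonneg _).trans this)

/-- At an interior point of an arm, the derivative along the arm agrees up to sign with the slope
along the first arm at that point. -/
theorem exists_sign_hasDerivAt {x : Γ} (k : Fin (valence x)) {t : ℝ} (ht : 0 < t)
    (ht' : t < radius x) :
    ∃ σ : ℝ, σ * σ = 1 ∧ ∀ f : Γ → ℝ, PiecewiseSmooth f → slopeSum f (arm x k t) = 0 →
      HasDerivAt (fun u => f (arm x k u)) (σ * slope f (arm x k t) (firstArm (arm x k t))) t := by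
  obtain ⟨r, hr, -, -, i, j, hij, hall, h⟩ := exists_arms_eq_arm k ht ht'
  have key : ∀ f : Γ → ℝ, PiecewiseSmooth f → slopeSum f (arm x k t) = 0 →
      slope f (arm x k t) j = -slope f (arm x k t) i ∧
      HasDerivAt (fun u => f (arm x k u)) (slope f (arm x k t) i) t := by
    intro f hf hs
    have hsum : slope f (arm x k t) j = -slope f (arm x k t) i := by
      have : (Finset.univ : Finset (Fin (valence (arm x k t)))) = {i, j} := by
        ext l; simpa using hall l
      rw [slopeSum_eq_sum_slope, this, Finset.sum_pair hij] at hs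
      linarith
    refine ⟨hsum, ?_⟩
    have hi := (hf.differentiable (arm x k t) i).hasDerivWithinAt
    have hj := (hf.differentiable (arm x k t) j).hasDerivWithinAt
    change HasDerivWithinAt _ (slope f (arm x k t) i) _ _ at hi
    change HasDerivWithinAt _ (slope f (arm x k t) j) _ _ at hj
    have hR : HasDerivWithinAt (fun u => f (arm x k u)) (slope f (arm x k t) i) (Ici t) t := by
      have h1 : HasDerivWithinAt (fun u : ℝ => u - t) 1 (Ici t) t :=
        ((hasDerivAt_id t).sub_const t).hasDerivWithinAt
      have h2 := HasDerivWithinAt.scomp_of_eq (h := fun u : ℝ => u - t) t hi h1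
        (fun u hu => mem_Ici.2 (sub_nonneg.2 hu)) (sub_self t).symm
      rw [one_smul] at h2
      refine h2.congr_of_eventuallyEq ?_ ?_
      · filter_upwards [Ico_mem_nhdsGE (show t < t + r by linarith)] with u hu
        simp only [Function.comp]
        rw [(h (u - t) ⟨by linarith [hu.1], by linarith [hu.2]⟩).1, add_sub_cancel]
      · simp
    have hL : HasDerivWithinAt (fun u => f (arm x k u)) (slope f (arm x k t) i) (Iic t) t := by
      have h1 : HasDerivWithinAt (fun u : ℝ => t - u) (-1) (Iic t) t :=
        ((hasDerivAt_id t).const_sub t).hasDerivWithinAt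
      have h2 := HasDerivWithinAt.scomp_of_eq (h := fun u : ℝ => t - u) t hj h1
        (fun u hu => mem_Ici.2 (sub_nonneg.2 hu)) (sub_self t).symm
      rw [hsum, smul_neg, neg_smul, one_smul, neg_neg] at h2
      refine h2.congr_of_eventuallyEq ?_ ?_
      · filter_upwards [Ioc_mem_nhdsLE (show t - r < t by linarith)] with u hu
        simp only [Function.comp]
        rw [(h (t - u) ⟨by linarith [hu.2], by linarith [hu.1]⟩).2, sub_sub_cancel]
      · simp
    have := hL.union hR
    rwa [Iic_union_Ici, hasDerivWithinAt_univ] at this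
  -- The sign records whether the first arm points forwards or backwards. It depends on the point
  -- alone and not on `f`, so it cancels in a product of two slopes.
  rcases hall (firstArm (arm x k t)) with h1 | h1
  · refine ⟨1, by norm_num, fun f hf hs => ?_⟩
    rw [h1, one_mul]
    exact (key f hf hs).2
  · refine ⟨-1, by norm_num, fun f hf hs => ?_⟩
    rw [h1, (key f hf hs).1, neg_mul_neg, one_mul]
    exact (key f hf hs).2

end Slope

/-- Integration by parts of F against the derivative of a quadratic polynomial. A countable set of
kinks is harmless because F is continuous and its derivative is bounded elsewhere. -/
theorem integral_deriv_mul_affine {F : ℝ → ℝ} {ρ C A B : ℝ} {s : Set ℝ} (hρ : 0 ≤ ρ)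
    (hs : s.Countable) (hF : ContinuousOn F (Icc 0 ρ)) (hF0 : F ρ = 0)
    (hd : ∀ t ∈ Ioo 0 ρ \ s, DifferentiableAt ℝ F t ∧ |deriv F t| ≤ C) :
    IntegrableOn (fun t => deriv F t * (B + 2 * A * t)) (Ioo 0 ρ) ∧
      ∫ t in Ioo 0 ρ, deriv F t * (B + 2 * A * t)
        = -(F 0 * B) - ∫ t in Ioo 0 ρ, F t * (2 * A) := by
  have hcont : Continuous fun t : ℝ => B + 2 * A * t := by fun_prop
  have hF2 : ContinuousOn (fun t => F t * (2 * A)) (Icc 0 ρ) := hF.mul continuousOn_const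
  have hI2 : IntegrableOn (fun t => F t * (2 * A)) (Ioo 0 ρ) :=
    (hF2.integrableOn_Icc).mono_set Ioo_subset_Icc_self
  have hI1 : IntegrableOn (deriv F) (Ioo 0 ρ) := by
    refine IntegrableOn.of_bound (by simp) (measurable_deriv F).aestronglyMeasurable C ?_
    have h0 : ∀ᵐ t ∂(volume : Measure ℝ), t ∉ s := measure_eq_zero_iff_ae_notMem.1 (hs.measure_zero _)
    filter_upwards [ae_restrict_mem measurableSet_Ioo, ae_restrict_of_ae h0] with t ht hts
    exact (hd t ⟨ht, hts⟩).2
  have hI : IntegrableOn (fun t => deriv F t * (B + 2 * A * t)) (Ioo 0 ρ) := by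
    refine IntegrableOn.mono_set ?_ Ioo_subset_Icc_self
    refine IntegrableOn.mul_continuousOn ?_ hcont.continuousOn isCompact_Icc
    rwa [integrableOn_Icc_iff_integrableOn_Ioo]
  refine ⟨hI, ?_⟩
  have hsum : IntegrableOn (fun t => deriv F t * (B + 2 * A * t) + F t * (2 * A)) (Ioo 0 ρ) :=
    hI.add hI2
  have hftc := integral_eq_of_hasDerivAt_off_countable_of_le
    (fun t => F t * (B + 2 * A * t)) (fun t => deriv F t * (B + 2 * A * t) + F t * (2 * A)) hρ hs
    (hF.mul hcont.continuousOn)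
    (fun t ht => by
      have h2 : HasDerivAt (fun t : ℝ => B + 2 * A * t) (2 * A) t := by
        simpa using ((hasDerivAt_id t).const_mul (2 * A)).const_add B
      exact (hd t ht).1.hasDerivAt.mul h2)
    ((intervalIntegrable_iff_integrableOn_Ioo_of_le hρ).2 hsum)
  rw [intervalIntegral.integral_of_le hρ, integral_Ioc_eq_integral_Ioo, integral_add hI hI2,
    hF0] at hftc
  linarith

section GradProd

variable {Γ : Type*} [MetricSpace Γ] [IsMetrizedGraph Γ] {f g : Γ → ℝ} {x : Γ}

/-- The integrand of the Dirichlet form. -/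
def gradProd (f g : Γ → ℝ) (y : Γ) : ℝ := slope f y (firstArm y) * slope g y (firstArm y)

theorem slope_eq_zero_of_far {c : ℝ} (h : ∀ y, c ≤ dist x y → f y = 0) {y : Γ}
    (hy : c < dist x y) (l : Fin (valence y)) : slope f y l = 0 := by
  have : HasGerm f y 0 0 := fun l => by
    filter_upwards [eventually_dist_arm_lt y l (sub_pos.2 hy)] with t ht
    have := dist_triangle x (arm y l t) y
    rw [dist_comm (arm y l t) y] at this
    rw [h _ (by linarith), h _ hy.le]
    simp
  rw [this.slope_eq]; rfl

theorem gradProd_arm (hf : PiecewiseSmooth f) {k : Fin (valence x)} {ρ A B C : ℝ}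
    (hρ : ρ ≤ radius x) (hq : ∀ t ∈ Ico 0 ρ, g (arm x k t) = C + B * t + A * t ^ 2)
    (hg : HasGerms g) {t : ℝ} (ht : t ∈ Ioo 0 ρ) (h0 : slopeSum f (arm x k t) = 0) :
    DifferentiableAt ℝ (fun u => f (arm x k u)) t ∧
      |deriv (fun u => f (arm x k u)) t| = |slope f (arm x k t) (firstArm (arm x k t))| ∧
      deriv (fun u => f (arm x k u)) t * (B + 2 * A * t) = gradProd f g (arm x k t) := by
  obtain ⟨σ, hσ, h⟩ := exists_sign_hasDerivAt k ht.1 (ht.2.trans_le hρ)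
  have hgs : slopeSum g (arm x k t) = 0 := by
    obtain ⟨a', b', hg', hs, -⟩ := hasGerm_arm_of_quadratic (k := k) hρ
      (fun t ht => hq t ⟨ht.1.le, ht.2⟩) ht
    rw [hg'.slopeSum_eq, hs]
  have h1 := h f hf h0
  have h2 := h g hg.piecewiseSmooth hgs
  have h3 : HasDerivAt (fun u => g (arm x k u)) (B + 2 * A * t) t := by
    refine (hasDerivAt_quadratic A B C t).congr_of_eventuallyEq ?_
    filter_upwards [Ioo_mem_nhds ht.1 ht.2] with u hu
    exact hq u ⟨hu.1.le, hu.2⟩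
  have h4 := h2.unique h3
  refine ⟨h1.differentiableAt, ?_, ?_⟩
  · have hσ1 : |σ| = 1 := by
      have : |σ| * |σ| = 1 := by rw [← abs_mul, hσ, abs_one]
      nlinarith [abs_nonneg σ]
    rw [h1.deriv, abs_mul, hσ1, one_mul]
  · rw [h1.deriv, ← h4, gradProd]
    linear_combination (slope f (arm x k t) (firstArm (arm x k t))
      * slope g (arm x k t) (firstArm (arm x k t))) * hσ

end GradProd

/-! ### Laplacians have total mass zero. -/

section MassZero

variable {Γ : Type*} [MetricSpace Γ] [MeasurableSpace Γ] [BorelSpace Γ] [IsMetrizedGraph Γ]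
  {f g : Γ → ℝ} {x : Γ}

/-- Green's formula for a piecewise smooth function supported in a star, on the arms of which `g`
is quadratic. -/
theorem integral_laplacian_eq_integral_gradProd (hf : PiecewiseSmooth f) (hg : HasGerms g)
    {A B : Fin (valence x) → ℝ} {c ρ : ℝ} (hρ : 0 < ρ) (hρR : ρ < radius x) (hc : c < ρ)
    (hq : ∀ k, ∀ t ∈ Ico 0 ρ, g (arm x k t) = g x + B k * t + A k * t ^ 2)
    (hfar : ∀ y, c ≤ dist x y → f y = 0) :
    Integrable (gradProd f g) μH[1] ∧
      ∫ᵛ y, f y ∂•(laplacian g) = ∫ y, gradProd f g y ∂μH[1] := by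
  classical
  obtain ⟨C, hC⟩ := hf.exists_bound
  have hDfar : ∀ y, ρ ≤ dist x y → gradProd f g y = 0 := fun y hy => by
    rw [gradProd, slope_eq_zero_of_far hfar (hc.trans_le hy), zero_mul]
  -- The kinks of `f` on the arm: a finite set, because the arm is injective and `f` has finitely
  -- many points with nonzero slope sum.
  set s : Fin (valence x) → Set ℝ := fun k => {t ∈ Ioo 0 ρ | slopeSum f (arm x k t) ≠ 0}
  have hs : ∀ k, (s k).Countable := fun k => by
    refine (Finite.of_finite_image (f := arm x k)
      (hf.finite_support.subset ?_) ?_).countable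
    · rintro _ ⟨t, ht, rfl⟩; exact ht.2
    · exact fun t ht u hu h => (arm_injective ht.1.1 (ht.1.2.trans hρR) hu.1.1.le
        (hu.1.2.trans hρR) h).2
  have hcont : ∀ k, ContinuousOn (fun t => f (arm x k t)) (Icc 0 ρ) := fun k => by
    refine hf.continuous.comp_continuousOn ?_
    have : LipschitzOnWith 1 (arm x k) (Icc 0 ρ) := LipschitzOnWith.of_dist_le_mul
      fun t ht u hu => by
        rw [dist_arm_same k ht.1 (ht.2.trans_lt hρR) hu.1 (hu.2.trans_lt hρR), Real.dist_eq]
        simp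
    exact this.continuousOn
  have hD := fun k t ht => gradProd_arm (k := k) (t := t) hf hρR.le (hq k) hg ht
  have h1 := fun k => integral_deriv_mul_affine (A := A k) (B := B k) (C := C) hρ.le (hs k) (hcont k)
    (hfar _ (by rw [dist_arm k hρ.le hρR]; exact hc.le)) fun t ht => by
      have h0 : slopeSum f (arm x k t) = 0 := by
        by_contra h; exact ht.2 ⟨ht.1, h⟩
      obtain ⟨d1, d2, -⟩ := hD k t ht.1 h0
      exact ⟨d1, d2 ▸ hC _ _⟩
  have hae : ∀ k, (fun t => deriv (fun u => f (arm x k u)) t * (B k + 2 * A k * t))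
      =ᵐ[volume.restrict (Ioo 0 ρ)] fun t => gradProd f g (arm x k t) := fun k => by
    have h0 : ∀ᵐ t ∂(volume : Measure ℝ), t ∉ s k :=
      measure_eq_zero_iff_ae_notMem.1 ((hs k).measure_zero _)
    filter_upwards [ae_restrict_mem measurableSet_Ioo, ae_restrict_of_ae h0] with t ht hts
    refine (hD k t ht ?_).2.2
    by_contra h; exact hts ⟨ht, h⟩
  have hDint : ∀ k, IntegrableOn (fun t => gradProd f g (arm x k t)) (Ioo 0 ρ) := fun k =>
    (h1 k).1.congr (hae k)
  refine ⟨?_, ?_⟩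
  · rw [← integrableOn_iff_integrable_of_support_subset (s := Metric.ball x ρ)]
    · exact integrableOn_ball hρ hρR.le hDint
    · intro y hy
      by_contra h
      exact hy (hDfar y (by rwa [Metric.mem_ball', not_lt] at h))
  have hgx : HasGerm g x A B := fun k => by
    filter_upwards [eventually_Ico hρ] with t ht using hq k t ht
  have heq : ∀ k, EqOn (fun t => f (arm x k t) * (2 * A k))
      (fun t => f (arm x k t) * secondDeriv g (arm x k t)) (Ioo 0 ρ) := fun k t ht => by
    simp only
    rw [(HasGerm.secondDeriv_arm hρR.le hq k ht).1]
  rw [integral_laplacian hf.continuous hg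
      (s := insert x hg.finite_support_slopeSum.toFinset) (by simp),
    Finset.sum_eq_single x, integral_eq_sum_arm (x := x) hρ hρR.le hDint hDfar,
    integral_eq_sum_arm (x := x) hρ hρR.le]
  · rw [hgx.slopeSum_eq, Finset.mul_sum, ← Finset.sum_neg_distrib, ← Finset.sum_sub_distrib]
    refine Finset.sum_congr rfl fun k _ => ?_
    rw [← integral_congr_ae (hae k), (h1 k).2, setIntegral_congr_fun measurableSet_Ioo (heq k),
      arm_zero]
    ring
  · intro k
    refine IntegrableOn.congr_fun ?_ (heq k) measurableSet_Ioo
    exact (((hcont k).mul continuousOn_const).integrableOn_Icc).mono_set Ioo_subset_Icc_self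
  · intro y hy
    rw [hfar y (hc.le.trans hy), zero_mul]
  · intro y _ hne
    by_cases hy : dist x y < ρ
    · obtain ⟨k, hk⟩ := exists_arm (hy.trans hρR)
      rw [← hk, (HasGerm.secondDeriv_arm hρR.le hq k ⟨dist_pos.2 hne.symm, hy⟩).2, mul_zero]
    · rw [hfar y (hc.le.trans (not_lt.1 hy)), zero_mul]
  · simp

/-- The Laplacian of a piecewise quadratic function has total mass zero. -/
theorem laplacian_univ (hg : HasGerms g) : laplacian g univ = 0 := by
  classical
  choose A B hgx using hg
  choose ρ' hρ' hρR' hq' using fun x => (hgx x).exists_radius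
  set ρ : Γ → ℝ := fun x => ρ' x / 2
  have hρ : ∀ x, 0 < ρ x := fun x => half_pos (hρ' x)
  have hρR : ∀ x, ρ x < radius x := fun x => (half_lt_self (hρ' x)).trans_le (hρR' x)
  have hq : ∀ x, ∀ k, ∀ t ∈ Ico 0 (ρ x), g (arm x k t) = g x + B x k * t + A x k * t ^ 2 :=
    fun x k t ht => hq' x k t ⟨ht.1, ht.2.trans (half_lt_self (hρ' x))⟩
  set c : Γ → ℝ := fun x => ρ x / 2
  have hc : ∀ x, 0 < c x := fun x => half_pos (hρ x)
  have hcρ : ∀ x, c x < ρ x := fun x => half_lt_self (hρ x)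
  obtain ⟨s, hs⟩ := exists_finset_cover hc
  set T : Γ → Γ → ℝ := fun x => tent x fun _ => c x
  have hT : ∀ x, HasGerms (T x) := fun x =>
    (hasLinearGerms_tent (fun _ => hc x) fun _ => (hcρ x).trans (hρR x)).hasGerms
  set S : Γ → ℝ := ∑ x ∈ s, T x
  have hS : HasGerms S := HasGerms.sum s hT
  have hSapp : ∀ y, S y = ∑ x ∈ s, T x y := fun y => Finset.sum_apply y s T
  have hSpos : ∀ y, 0 < S y := by
    intro y
    rw [hSapp]
    refine Finset.sum_pos' (fun x _ => tent_nonneg y) ?_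
    obtain ⟨x, hx, hxy⟩ := hs y
    refine ⟨x, hx, ?_⟩
    have hR : dist x y < radius x := (hxy.trans (hcρ x)).trans (hρR x)
    obtain ⟨k, hk⟩ := exists_arm hR
    simp only [T]
    rw [← hk, tent_arm k dist_nonneg hR]
    refine lt_max_of_lt_right ?_
    have := (div_lt_one (hc x)).2 hxy
    linarith
  -- A partition of unity subordinate to stars on whose arms `g` is quadratic, so that Green's
  -- formula applies to each summand.
  set χ : Γ → Γ → ℝ := fun x y => T x y / S y
  have hχ : ∀ x, PiecewiseSmooth (χ x) := fun x =>
    (hT x).piecewiseSmooth.div hS.piecewiseSmooth hSpos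
  have hχ1 : ∀ y, ∑ x ∈ s, χ x y = 1 := fun y => by
    simp only [χ]
    rw [← Finset.sum_div, ← hSapp, div_self (hSpos y).ne']
  have hlocal := fun x => integral_laplacian_eq_integral_gradProd (hχ x) (fun x => ⟨_, _, hgx x⟩)
    (hρ x) (hρR x) (hcρ x) (hq x) fun y hy => by
      simp only [χ, T]
      rw [tent_eq_zero (fun _ => hc x) fun _ => hy, zero_div]
  -- The functions χ sum to 1, so their slopes sum to 0 at every point.
  have hgrad : ∀ y, ∑ x ∈ s, gradProd (χ x) g y = 0 := by
    intro y
    have h1 : HasDerivWithinAt (fun t => ∑ x ∈ s, χ x (arm y (firstArm y) t))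
        (∑ x ∈ s, slope (χ x) y (firstArm y)) (Ici 0) 0 :=
      HasDerivWithinAt.fun_sum fun x _ => ((hχ x).differentiable y _).hasDerivWithinAt
    simp only [hχ1] at h1
    have h2 := (uniqueDiffWithinAt_Ici (0 : ℝ)).eq_deriv _ h1 (hasDerivWithinAt_const _ _ _)
    simp only [gradProd]
    rw [← Finset.sum_mul, h2, zero_mul]
  calc laplacian g univ = ∫ᵛ y, (1 : ℝ) ∂•(laplacian g) := by
        rw [integral_function_const, one_mul]
    _ = ∫ᵛ y, ∑ x ∈ s, χ x y ∂•(laplacian g) := by simp only [hχ1]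
    _ = ∑ x ∈ s, ∫ᵛ y, χ x y ∂•(laplacian g) :=
        VectorMeasure.integral_finsetSum s fun x _ =>
          integrable_variation_of_continuous (hχ x).continuous _
    _ = ∑ x ∈ s, ∫ y, gradProd (χ x) g y ∂μH[1] :=
        Finset.sum_congr rfl fun x _ => (hlocal x).2
    _ = ∫ y, ∑ x ∈ s, gradProd (χ x) g y ∂μH[1] :=
        (integral_finsetSum s fun x _ => (hlocal x).1).symm
    _ = 0 := by simp [hgrad]

/-- Green's formula for a function `v` with Laplacian `δ_x - δ_y`. -/
theorem integral_laplacian_of_potential (hg : HasGerms g) {v : Γ → ℝ} (hv : HasGerms v) {x y : Γ}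
    (h : laplacian v = diracAt x - diracAt y) : ∫ᵛ z, v z ∂•(laplacian g) = g x - g y := by
  obtain ⟨w, hw, hΔ, hwg⟩ := exists_potential hg x y
  -- Any two potentials differ by a constant, which integrates to zero since the Laplacian of `g`
  -- has mass zero.
  have h1 : ∀ z, v z = w z + (v x - w x) := fun z => by
    have := sub_eq_of_laplacian_eq hv hw (h.trans hΔ.symm) z x
    linarith
  rw [← hwg, funext h1, integral_function_add hw.continuous continuous_const,
    integral_function_const, laplacian_univ hg, mul_zero, add_zero]

end MassZero

/-- The arms are kept short enough that `o` is either the centre or outside the open ball. All tents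
on `x` with arms of length at most `a` then agree at `o`, so their differences respect the
normalization of the voltage. -/
theorem exists_arm_length {Γ : Type*} [MetricSpace Γ] [IsMetrizedGraph Γ] (o x : Γ) :
    ∃ a, 0 < a ∧ a < radius x ∧ (o = x ∨ a ≤ dist x o) := by
  by_cases h : o = x
  · exact ⟨radius x / 2, half_pos (radius_pos x), half_lt_self (radius_pos x), Or.inl h⟩
  · have hd : 0 < dist x o := dist_pos.2 (Ne.symm h)
    exact ⟨min (radius x / 2) (dist x o), lt_min (half_pos (radius_pos x)) hd,
      (min_le_left _ _).trans_lt (half_lt_self (radius_pos x)), Or.inr (min_le_right _ _)⟩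

/-! ### The voltage function and its dependence on the source. -/

section Voltage

variable {Γ : Type*} [MetricSpace Γ] [MeasurableSpace Γ] [BorelSpace Γ] [IsMetrizedGraph Γ]

theorem exists_voltage (o x : Γ) :
    ∃ v : Γ → ℝ, HasGerms v ∧ laplacian v = diracAt x - diracAt o ∧ v o = 0 := by
  obtain ⟨v, hv, hΔ, -⟩ := exists_potential (hasGerms_const (Γ := Γ) 0) x o
  refine ⟨v - fun _ => v o, hv.sub (hasGerms_const _), ?_, sub_self _⟩
  rw [laplacian_sub hv (hasGerms_const _), laplacian_const, sub_zero, hΔ]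

/-- The potential of a unit current from `x` to `o`, normalized to be zero at `o`. -/
def voltage (o x : Γ) : Γ → ℝ := (exists_voltage o x).choose

variable (o : Γ)

theorem hasGerms_voltage (x : Γ) : HasGerms (voltage o x) := (exists_voltage o x).choose_spec.1

theorem laplacian_voltage (x : Γ) : laplacian (voltage o x) = diracAt x - diracAt o :=
  (exists_voltage o x).choose_spec.2.1

theorem voltage_base (x : Γ) : voltage o x o = 0 := (exists_voltage o x).choose_spec.2.2

/-- Reciprocity: Green's formula applied to the two voltages, whose values at the base point vanish.
-/
theorem voltage_symm (x z : Γ) : voltage o x z = voltage o z x := by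
  have h := integral_laplacian_of_potential (hasGerms_voltage o z) (hasGerms_voltage o x)
    (laplacian_voltage o x)
  rw [laplacian_voltage, integral_vectorMeasure_sub (hasGerms_voltage o x).continuous,
    integral_diracAt, integral_diracAt, voltage_base, voltage_base] at h
  linarith

theorem voltage_eq {x : Γ} {v : Γ → ℝ} (hv : HasGerms v)
    (h : laplacian v = diracAt x - diracAt o) (h0 : v o = 0) (z : Γ) : voltage o x z = v z := by
  have := sub_eq_of_laplacian_eq (hasGerms_voltage o x) hv ((laplacian_voltage o x).trans h.symm) z o
  rw [voltage_base, h0] at this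
  linarith

theorem hasLinearGerms_voltage (x : Γ) : HasLinearGerms (voltage o x) := fun z => by
  obtain ⟨b, hb, -⟩ := hasGerm_of_laplacian (hasGerms_voltage o x) (s := {x, o}) (by simp)
    (fun A _ hA => by
      rw [Set.disjoint_right] at hA
      rw [laplacian_voltage, _root_.sub_apply,
        VectorMeasure.dirac_apply_of_notMem (hA (by simp)),
        VectorMeasure.dirac_apply_of_notMem (hA (by simp)), sub_zero]) z
  exact ⟨b, hb⟩

/-- Dependence of the potential on the position of the source along an arm. -/
theorem voltage_arm {x : Γ} {a : ℝ} (haR : a < radius x) (ho : o = x ∨ a ≤ dist x o)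
    (k : Fin (valence x)) {t : ℝ} (ht : 0 < t) (hta : t < a) (z : Γ) :
    voltage o (arm x k t) z = (1 - t / a) * voltage o x z + t / a * voltage o (arm x k a) z
      + t * (tent x (fun _ => a) z - tent x (Function.update (fun _ => a) k t) z) := by
  classical
  have ha0 : 0 < a := ht.trans hta
  set a' : Fin (valence x) → ℝ := Function.update (fun _ => a) k t with ha'
  have h1 : ∀ l, 0 < a' l := fun l => by rcases eq_or_ne l k with rfl | hne <;> simp [*]
  have h2 : ∀ l, a' l ≤ a := fun l => by
    rcases eq_or_ne l k with rfl | hne <;> simp [hta.le, *]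
  have h3 : ∀ l, a' l < radius x := fun l => (h2 l).trans_lt haR
  have hT := (hasLinearGerms_tent (x := x) (a := fun _ => a) (fun _ => ha0) fun _ => haR).hasGerms
  have hT' := (hasLinearGerms_tent h1 h3).hasGerms
  have hVx := hasGerms_voltage o x
  have hVq := hasGerms_voltage o (arm x k a)
  refine voltage_eq o (v := (1 - t / a) • voltage o x + (t / a) • voltage o (arm x k a)
    + t • (tent x (fun _ => a) - tent x a')) ?_ ?_ ?_ z
  · exact ((hVx.smul _).add (hVq.smul _)).add ((hT.sub hT').smul _)
  -- The tents differ only on arm `k`. Multiplied by `t`, the difference of Laplacians moves the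
  -- interpolated source masses at `x` and at `arm x k a` to a unit mass at `arm x k t`.
  · have hdiff : laplacian (tent x fun _ => a) - laplacian (tent x a')
        = (1 / a) • (diracAt x - diracAt (arm x k a))
          - (1 / t) • (diracAt x - diracAt (arm x k t)) := by
      rw [laplacian_tent (fun _ => ha0) fun _ => haR, laplacian_tent h1 h3,
        ← Finset.sum_sub_distrib, Finset.sum_eq_single k]
      · simp [ha']
      · intro l _ hne; simp [ha', hne]
      · simp
    rw [laplacian_add ((hVx.smul _).add (hVq.smul _)) ((hT.sub hT').smul _),
      laplacian_add (hVx.smul _) (hVq.smul _), laplacian_smul hVx, laplacian_smul hVq,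
      laplacian_smul (hT.sub hT'), laplacian_sub hT hT', hdiff, laplacian_voltage,
      laplacian_voltage]
    match_scalars <;> field_simp <;> ring
  · have hTo : tent x (fun _ => a) o = tent x a' o := by
      rcases ho with rfl | ho
      · rw [tent_self, tent_self]
      · rw [tent_eq_zero (fun _ => ha0) fun _ => ho, tent_eq_zero h1 fun l => (h2 l).trans ho]
    simp [voltage_base, hTo]

/-- Set z = `arm x k t` in `voltage_arm`: the two voltages on the right are linear in t with
coefficients linear in t, the long tent equals 1 − t/a, and the short one vanishes at its own tip.
The result is quadratic in t. -/
theorem hasGerms_voltage_diag : HasGerms fun y => voltage o y y := by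
  classical
  intro x
  obtain ⟨a, ha, haR, ho⟩ := exists_arm_length o x
  obtain ⟨b, hb⟩ := hasLinearGerms_voltage o x x
  choose b' hb' using fun k => hasLinearGerms_voltage o (arm x k a) x
  refine ⟨fun k => -b k / a + b' k k / a - 1 / a,
    fun k => b k - voltage o x x / a + voltage o (arm x k a) x / a + 1, fun k => ?_⟩
  filter_upwards [eventually_Ico ha, hb k, hb' k k] with t ht h1 h2
  rcases eq_or_lt_of_le ht.1 with rfl | h0
  · simp
  rw [voltage_arm o haR ho k h0 ht.2, h1, h2, tent_arm k ht.1 (ht.2.trans haR),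
    tent_arm k ht.1 (ht.2.trans haR), Function.update_self, div_self h0.ne', sub_self, max_self,
    max_eq_right (by linarith [(div_lt_one ha).2 ht.2])]
  simp only [Pi.zero_apply]
  field_simp
  ring

/-- By compactness it suffices that y ↦ `voltage o y` is continuous in the sup norm, and
`voltage_arm` gives a Lipschitz bound at each `x`, uniform in the second variable. -/
theorem continuous_voltage : Continuous (Function.uncurry (voltage o)) := by
  classical
  have hVc : ∀ x, Continuous (voltage o x) := fun x => (hasGerms_voltage o x).continuous
  set V : Γ → C(Γ, ℝ) := fun x => ⟨voltage o x, hVc x⟩ with hV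
  suffices Continuous V from ContinuousMap.continuous_uncurry_of_continuous ⟨V, this⟩
  rw [continuous_iff_continuousAt]
  intro x
  obtain ⟨a, ha, haR, ho⟩ := exists_arm_length o x
  set M : ℝ := ∑ k, ((‖V x‖ + ‖V (arm x k a)‖) / a + 1)
  have hM0 : ∀ k, 0 ≤ (‖V x‖ + ‖V (arm x k a)‖) / a + 1 := fun k => by positivity
  have hbound : ∀ y ∈ Metric.ball x a, dist (V y) (V x) ≤ M * dist y x := by
    intro y hy
    rw [Metric.mem_ball'] at hy
    rw [dist_comm y x]
    obtain ⟨k, t, ht, ht', htd, rfl⟩ : ∃ k t, 0 ≤ t ∧ t < a ∧ t = dist x y ∧ arm x k t = y :=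
      let ⟨k, hk⟩ := exists_arm (hy.trans haR); ⟨k, _, dist_nonneg, hy, rfl, hk⟩
    rw [← htd]
    have hM : 0 ≤ M := Finset.sum_nonneg fun k _ => hM0 k
    rcases eq_or_lt_of_le ht with h0 | h0
    · rw [← h0, arm_zero, dist_self, mul_zero]
    rw [ContinuousMap.dist_le (mul_nonneg hM ht)]
    intro z
    have e1 : |voltage o x z| ≤ ‖V x‖ := (V x).norm_coe_le_norm z
    have e2 : |voltage o (arm x k a) z| ≤ ‖V (arm x k a)‖ := (V (arm x k a)).norm_coe_le_norm z
    have t1 := tent_nonneg (x := x) (a := fun _ => a) z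
    have t2 := tent_nonneg (x := x) (a := Function.update (fun _ => a) k t) z
    have t3 := tent_le_one (x := x) (a := fun _ => a) (fun _ => ha) z
    have t4 := tent_le_one (x := x) (a := Function.update (fun _ => a) k t)
      (fun l => by
        rcases eq_or_ne l k with rfl | hne
        · simpa using h0
        · simpa [hne] using ha) z
    change |voltage o (arm x k t) z - voltage o x z| ≤ M * t
    rw [voltage_arm o haR ho k h0 ht']
    set T₁ := tent x (fun _ => a) z
    set T₂ := tent x (Function.update (fun _ => a) k t) z
    have h1 : (1 - t / a) * voltage o x z + t / a * voltage o (arm x k a) z + t * (T₁ - T₂)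
        - voltage o x z = ((voltage o (arm x k a) z - voltage o x z) / a + (T₁ - T₂)) * t := by
      field_simp; ring
    rw [h1, abs_mul, abs_of_nonneg ht]
    refine mul_le_mul_of_nonneg_right ?_ ht
    refine le_trans ?_ (Finset.single_le_sum (f := fun k => (‖V x‖ + ‖V (arm x k a)‖) / a + 1)
      (fun k _ => hM0 k) (Finset.mem_univ k))
    refine (abs_add_le _ _).trans (add_le_add ?_ (abs_le.2 ⟨by linarith, by linarith⟩))
    rw [abs_div, abs_of_pos ha]
    refine div_le_div_of_nonneg_right ((abs_sub _ _).trans ?_) ha.le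
    linarith
  rw [ContinuousAt, tendsto_iff_dist_tendsto_zero]
  refine squeeze_zero' (Eventually.of_forall fun _ => dist_nonneg)
    (eventually_of_mem (Metric.ball_mem_nhds x ha) hbound) ?_
  have : Tendsto (fun y => M * dist y x) (𝓝 x) (𝓝 (M * dist x x)) :=
    (continuous_const.mul (continuous_id.dist continuous_const)).tendsto x
  simpa using this

end Voltage

/-! ### Effective resistance, canonical measure and tau-invariant. -/

section Resistance

variable {Γ : Type*} [MetricSpace Γ] [MeasurableSpace Γ] [BorelSpace Γ] [IsMetrizedGraph Γ]

/-- Every potential for δ_x − δ_y equals `voltage o x - voltage o y` up to a constant, and a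
constant does not affect the drop from `x` to `y`. -/
theorem isEffectiveResistance_iff (o x y : Γ) (R : ℝ) :
    IsEffectiveResistance x y R ↔ R = voltage o x x + voltage o y y - 2 * voltage o x y := by
  have hV := (hasGerms_voltage o x).sub (hasGerms_voltage o y)
  have hΔ : laplacian (voltage o x - voltage o y) = diracAt x - diracAt y := by
    rw [laplacian_sub (hasGerms_voltage o x) (hasGerms_voltage o y), laplacian_voltage,
      laplacian_voltage, sub_sub_sub_cancel_right]
  have hs := voltage_symm o x y
  constructor
  · rintro ⟨f, hf, hfΔ, rfl⟩
    have := sub_eq_of_laplacian_eq hf.hasGerms hV (hfΔ.trans hΔ.symm) x y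
    simp only [Pi.sub_apply] at this
    linarith
  · rintro rfl
    refine ⟨_, hV.isPiecewiseQuadratic, hΔ, ?_⟩
    simp only [Pi.sub_apply]
    linarith

theorem existsUnique_isEffectiveResistance (x y : Γ) : ∃! R, IsEffectiveResistance x y R :=
  ⟨_, (isEffectiveResistance_iff x x y _).2 rfl, fun R hR => (isEffectiveResistance_iff x x y R).1 hR⟩

theorem resistance_eq (o x y : Γ) :
    resistance x y = voltage o x x + voltage o y y - 2 * voltage o x y :=
  (isEffectiveResistance_iff o x y _).1
    (Classical.epsilon_spec (existsUnique_isEffectiveResistance x y).exists)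

theorem resistance_self (x : Γ) : resistance x x = 0 := by
  rw [resistance_eq x]; ring

theorem resistance_symm (x y : Γ) : resistance x y = resistance y x := by
  rw [resistance_eq x, resistance_eq x y x, voltage_symm x x y]; ring

theorem resistance_eq_fun (o x : Γ) :
    resistance x = ((fun _ => voltage o x x) + fun y => voltage o y y) + (-2 : ℝ) • voltage o x := by
  ext y
  rw [resistance_eq o]
  simp only [Pi.add_apply, Pi.smul_apply, smul_eq_mul]
  ring

theorem hasGerms_resistance (x : Γ) : HasGerms (resistance x) := by
  rw [resistance_eq_fun x]
  exact ((hasGerms_const _).add (hasGerms_voltage_diag x)).add ((hasGerms_voltage x x).smul _)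

theorem continuous_resistance : Continuous (Function.uncurry (resistance (Γ := Γ))) := by
  obtain ⟨o⟩ : Nonempty Γ := inferInstance
  have hD := (hasGerms_voltage_diag o).continuous
  have : Function.uncurry (resistance (Γ := Γ)) = fun p => voltage o p.1 p.1 + voltage o p.2 p.2
      - 2 * Function.uncurry (voltage o) p := by
    ext p; exact resistance_eq o p.1 p.2
  rw [this]
  exact ((hD.comp continuous_fst).add (hD.comp continuous_snd)).sub
    (continuous_const.mul (continuous_voltage o))

/-- In r(x, y) = V_x(x) + V_y(y) − 2V_x(y) the first term is constant in y and the last contributes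
−(δ_x − δ_o). Adding δ_x leaves an expression free of `x`. -/
theorem half_laplacian_resistance (o x : Γ) :
    (1 / 2 : ℝ) • laplacian (resistance x) + diracAt x
      = (1 / 2 : ℝ) • laplacian (fun y => voltage o y y) + diracAt o := by
  have hD := hasGerms_voltage_diag o
  have hV := hasGerms_voltage o x
  rw [resistance_eq_fun o, laplacian_add ((hasGerms_const _).add hD) (hV.smul _),
    laplacian_add (hasGerms_const _) hD, laplacian_const, laplacian_smul hV, laplacian_voltage]
  match_scalars <;> norm_num

theorem isCanonicalMeasure_iff (o : Γ) (μ : SignedMeasure Γ) :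
    IsCanonicalMeasure μ ↔ μ = (1 / 2 : ℝ) • laplacian (fun y => voltage o y y) + diracAt o := by
  constructor
  · intro h
    rw [(h o).2, half_laplacian_resistance o]
  · rintro rfl x
    exact ⟨(hasGerms_resistance x).isPiecewiseQuadratic, (half_laplacian_resistance o x).symm⟩

theorem existsUnique_isCanonicalMeasure : ∃! μ : SignedMeasure Γ, IsCanonicalMeasure μ := by
  obtain ⟨o⟩ : Nonempty Γ := inferInstance
  exact ⟨_, (isCanonicalMeasure_iff o _).2 rfl, fun μ hμ => (isCanonicalMeasure_iff o μ).1 hμ⟩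

theorem canonicalMeasure_eq (x : Γ) :
    canonicalMeasure Γ = (1 / 2 : ℝ) • laplacian (resistance x) + diracAt x :=
  (Classical.epsilon_spec (existsUnique_isCanonicalMeasure (Γ := Γ)).exists x).2

theorem laplacian_resistance (x : Γ) :
    laplacian (resistance x) = (2 : ℝ) • (canonicalMeasure Γ - diracAt x) := by
  rw [canonicalMeasure_eq x]
  match_scalars <;> norm_num

theorem canonicalMeasure_univ : canonicalMeasure Γ univ = 1 := by
  obtain ⟨o⟩ : Nonempty Γ := inferInstance
  rw [canonicalMeasure_eq o, _root_.add_apply, _root_.smul_apply,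
    laplacian_univ (hasGerms_resistance o), smul_zero, zero_add, diracAt_univ]

/-- The function ½(r(x, ·) − r(x', ·)) has Laplacian δ_x' − δ_x. Green's formula with r(x, ·)
evaluates its integral as r(x, x'), and the Dirac part of μ_can contributes −r(x', x). -/
theorem integral_resistance_canonicalMeasure (x x' : Γ) :
    ∫ᵛ y, resistance x y ∂•(canonicalMeasure Γ) = ∫ᵛ y, resistance x' y ∂•(canonicalMeasure Γ) := by
  have hx := hasGerms_resistance x
  have hx' := hasGerms_resistance x'
  have hc := hx.continuous
  have hc' := hx'.continuous
  have hv : HasGerms ((1 / 2 : ℝ) • (resistance x - resistance x')) := (hx.sub hx').smul _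
  have hΔ : laplacian ((1 / 2 : ℝ) • (resistance x - resistance x'))
      = diracAt x' - diracAt x := by
    rw [laplacian_smul (hx.sub hx'), laplacian_sub hx hx', laplacian_resistance,
      laplacian_resistance]
    match_scalars <;> norm_num
  have h1 := integral_laplacian_of_potential hx hv hΔ
  have h2 : ∫ᵛ y, ((1 / 2 : ℝ) • (resistance x - resistance x')) y ∂•(laplacian (resistance x))
      = (1 / 2) * ∫ᵛ y, (resistance x y - resistance x' y) ∂•(laplacian (resistance x)) :=
    integral_function_mul _ _ _
  have hcc : Continuous fun y => resistance x y - resistance x' y := hc.sub hc'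
  rw [← sub_eq_zero, ← integral_function_sub hc hc', canonicalMeasure_eq x,
    integral_vectorMeasure_add hcc, integral_vectorMeasure_smul, ← h2, h1,
    integral_diracAt, resistance_self, resistance_symm x' x]
  ring

theorem existsUnique_isTauInvariant : ∃! t, IsTauInvariant Γ t := by
  obtain ⟨o⟩ : Nonempty Γ := inferInstance
  exact ⟨_, fun x => by rw [integral_resistance_canonicalMeasure x o], fun t ht => ht o⟩

theorem integral_resistance_eq_tau (x : Γ) :
    ∫ᵛ y, resistance x y ∂•(canonicalMeasure Γ) = 2 * tau Γ := by
  have := Classical.epsilon_spec (existsUnique_isTauInvariant (Γ := Γ)).exists x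
  rw [← tau] at this
  linarith

end Resistance

/-! ### The Green's function and the final identity. -/

section GreenFunction

theorem IsPolarization.sum_eq {X : Type*} {g : ℕ} {K : X →₀ ℤ} (hK : IsPolarization g K) :
    ∑ z ∈ K.support, (K z : ℝ) = 2 * (g : ℝ) - 2 := by
  have h := hK.2
  rw [Finsupp.sum] at h
  exact_mod_cast h

theorem IsPolarization.genus_ne_zero {X : Type*} {g : ℕ} {K : X →₀ ℤ} (hK : IsPolarization g K) :
    (g : ℝ) ≠ 0 := by
  have := hK.1
  positivity

theorem divisorMeasure_univ {X : Type*} [MeasurableSpace X] {g : ℕ} {K : X →₀ ℤ} (hK : IsPolarization g K) :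
    divisorMeasure K univ = 2 * (g : ℝ) - 2 := by
  rw [divisorMeasure, Finsupp.sum, _root_.sum_apply, ← hK.sum_eq]
  refine Finset.sum_congr rfl fun z _ => ?_
  rw [_root_.smul_apply, diracAt_univ, smul_eq_mul, mul_one]

variable {Γ : Type*} [MetricSpace Γ] [MeasurableSpace Γ] [BorelSpace Γ] [IsMetrizedGraph Γ]

theorem laplacian_sum {ι : Type*} (s : Finset ι) {F : ι → Γ → ℝ} (h : ∀ i, HasGerms (F i)) :
    laplacian (∑ i ∈ s, F i) = ∑ i ∈ s, laplacian (F i) := by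
  classical
  induction s using Finset.induction_on with
  | empty => exact laplacian_const 0
  | insert i s hi ih =>
    rw [Finset.sum_insert hi, Finset.sum_insert hi, laplacian_add (h i) (HasGerms.sum s h), ih]

/-- The potential `∑ (K(z) / 2g) r(z, ·)` of the divisor part of the admissible measure. -/
def divisorPotential (g : ℕ) (K : Γ →₀ ℤ) : Γ → ℝ :=
  ∑ z ∈ K.support, ((K z : ℝ) / (2 * (g : ℝ))) • resistance z

theorem divisorPotential_apply (g : ℕ) (K : Γ →₀ ℤ) (x : Γ) :
    divisorPotential g K x = ∑ z ∈ K.support, (K z : ℝ) / (2 * (g : ℝ)) * resistance z x := by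
  simp [divisorPotential]

theorem hasGerms_divisorPotential (g : ℕ) (K : Γ →₀ ℤ) : HasGerms (divisorPotential g K) :=
  HasGerms.sum _ fun z => (hasGerms_resistance z).smul _

/-- The weights K(z)/2g sum to (g − 1)/g, so the Laplacian is (2 − 2/g)μ_can − δ_K/g; the definition
of μ_a absorbs the terms over g. -/
theorem laplacian_divisorPotential {g : ℕ} {K : Γ →₀ ℤ} (hK : IsPolarization g K) :
    laplacian (divisorPotential g K)
      = (2 : ℝ) • canonicalMeasure Γ - (2 : ℝ) • admissibleMeasure g K := by
  have hg := hK.genus_ne_zero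
  have h1 : laplacian (divisorPotential g K) = ∑ z ∈ K.support,
      (((K z : ℝ) * (g : ℝ)⁻¹) • canonicalMeasure Γ - (g : ℝ)⁻¹ • ((K z : ℝ) • diracAt z)) := by
    rw [divisorPotential, laplacian_sum _ fun z => (hasGerms_resistance z).smul _]
    refine Finset.sum_congr rfl fun z _ => ?_
    rw [laplacian_smul (hasGerms_resistance z), laplacian_resistance]
    match_scalars <;> field_simp
  have h2 : ∑ z ∈ K.support, ((K z : ℝ) * (g : ℝ)⁻¹) • canonicalMeasure Γ
      = ((2 * (g : ℝ) - 2) * (g : ℝ)⁻¹) • canonicalMeasure Γ := by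
    have : (∑ z ∈ K.support, ((K z : ℝ) * (g : ℝ)⁻¹)) • canonicalMeasure Γ
      = ∑ z ∈ K.support, ((K z : ℝ) * (g : ℝ)⁻¹) • canonicalMeasure Γ := Finset.sum_smul
    rw [← this, ← Finset.sum_mul, hK.sum_eq]
  have h3 : ∑ z ∈ K.support, (g : ℝ)⁻¹ • ((K z : ℝ) • diracAt z)
      = (g : ℝ)⁻¹ • divisorMeasure K := Finset.smul_sum.symm
  rw [h1, Finset.sum_sub_distrib, h2, h3, admissibleMeasure]
  match_scalars <;> field_simp

theorem divisorMeasure_eq {g : ℕ} {K : Γ →₀ ℤ} (hK : IsPolarization g K) :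
    divisorMeasure K
      = (2 * (g : ℝ)) • admissibleMeasure g K - (2 : ℝ) • canonicalMeasure Γ := by
  have hg := hK.genus_ne_zero
  rw [admissibleMeasure]
  match_scalars <;> field_simp
  ring

theorem admissibleMeasure_univ {g : ℕ} {K : Γ →₀ ℤ} (hK : IsPolarization g K) :
    admissibleMeasure g K univ = 1 := by
  have hg := hK.genus_ne_zero
  rw [admissibleMeasure, _root_.smul_apply, _root_.add_apply, _root_.smul_apply,
    divisorMeasure_univ hK, canonicalMeasure_univ, smul_eq_mul, smul_eq_mul]
  field_simp
  ring

theorem integral_divisorMeasure {f : Γ → ℝ} (hf : Continuous f) (K : Γ →₀ ℤ) :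
    ∫ᵛ y, f y ∂•(divisorMeasure K) = ∑ z ∈ K.support, (K z : ℝ) * f z := by
  rw [divisorMeasure, Finsupp.sum, integral_vectorMeasure_sum hf]
  exact Finset.sum_congr rfl fun z _ => by rw [integral_vectorMeasure_smul, integral_diracAt]

theorem integral_resistance_admissibleMeasure (g : ℕ) (K : Γ →₀ ℤ) (x : Γ) :
    ∫ᵛ y, resistance x y ∂•(admissibleMeasure g K)
      = divisorPotential g K x + 2 * tau Γ / g := by
  have hc : Continuous fun y => resistance x y := (hasGerms_resistance x).continuous
  rw [admissibleMeasure, integral_vectorMeasure_smul, integral_vectorMeasure_add hc,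
    integral_vectorMeasure_smul, integral_resistance_eq_tau, integral_divisorMeasure hc,
    divisorPotential_apply, mul_add, Finset.mul_sum]
  congr 1
  · refine Finset.sum_congr rfl fun z _ => ?_
    rw [resistance_symm]
    ring
  · ring

theorem integral_divisorPotential_canonicalMeasure {g : ℕ} {K : Γ →₀ ℤ}
    (hK : IsPolarization g K) :
    ∫ᵛ y, divisorPotential g K y ∂•(canonicalMeasure Γ) = 2 * tau Γ * (g - 1) / g := by
  have hg := hK.genus_ne_zero
  have h1 : ∫ᵛ y, divisorPotential g K y ∂•(canonicalMeasure Γ)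
      = ∑ z ∈ K.support, (K z : ℝ) / (2 * (g : ℝ)) * (2 * tau Γ) := by
    simp_rw [divisorPotential_apply]
    rw [VectorMeasure.integral_finsetSum]
    · exact Finset.sum_congr rfl fun z _ => by
        rw [integral_function_mul, integral_resistance_eq_tau]
    · exact fun z _ => integrable_variation_of_continuous
        (continuous_const.mul (hasGerms_resistance z).continuous) _
  rw [h1, ← Finset.sum_mul, ← Finset.sum_div, hK.sum_eq]
  field_simp

/-- The additive constant in the Green's function. -/
def greenConst (g : ℕ) (K : Γ →₀ ℤ) : ℝ :=
  tau Γ / g - (1 / 2) * ∫ᵛ y, divisorPotential g K y ∂•(admissibleMeasure g K)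

/-- The Green's function in terms of the resistance function. -/
def greenKernel (g : ℕ) (K : Γ →₀ ℤ) (x y : Γ) : ℝ :=
  -(1 / 2) * resistance x y + (1 / 2) * divisorPotential g K x
    + (1 / 2) * divisorPotential g K y + greenConst g K

theorem greenKernel_eq (g : ℕ) (K : Γ →₀ ℤ) (x : Γ) :
    greenKernel g K x = (-(1 / 2) : ℝ) • resistance x + ((1 / 2 : ℝ) • divisorPotential g K
      + fun _ => (1 / 2) * divisorPotential g K x + greenConst g K) := by
  ext y
  simp only [greenKernel, Pi.add_apply, Pi.smul_apply, smul_eq_mul]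
  ring

/-- The resistance term contributes δ_x − μ_can and the divisor potential μ_can − μ_a. Integrating
against μ_a, the resistance yields −½D(x) − τ/g, which the term ½D(x) and the constant `greenConst`
compensate for every `x`. -/
theorem isGreenFunction_greenKernel {g : ℕ} {K : Γ →₀ ℤ} (hK : IsPolarization g K) :
    IsGreenFunction g K (greenKernel g K) := by
  have hk := hasGerms_divisorPotential g K
  have hkc := hk.continuous
  refine ⟨?_, fun x => ?_⟩
  · have h1 : Continuous fun p : Γ × Γ => resistance p.1 p.2 := continuous_resistance
    change Continuous fun p : Γ × Γ => greenKernel g K p.1 p.2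
    unfold greenKernel
    exact (((continuous_const.mul h1).add (continuous_const.mul (hkc.comp continuous_fst))).add
      (continuous_const.mul (hkc.comp continuous_snd))).add continuous_const
  · have hr := (hasGerms_resistance x).smul (-(1 / 2))
    have hs := (hk.smul (1 / 2)).add
      (hasGerms_const ((1 / 2) * divisorPotential g K x + greenConst g K))
    refine ⟨?_, ?_, ?_⟩
    · rw [greenKernel_eq]
      exact (hr.add hs).isPiecewiseQuadratic
    · rw [greenKernel_eq, laplacian_add hr hs, laplacian_add (hk.smul _) (hasGerms_const _),
        laplacian_smul (hasGerms_resistance x), laplacian_smul hk, laplacian_const,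
        laplacian_resistance, laplacian_divisorPotential hK]
      module
    · have hc : Continuous fun y => resistance x y := (hasGerms_resistance x).continuous
      have h : ∀ y, greenKernel g K x y = -(1 / 2) * resistance x y
          + ((1 / 2) * divisorPotential g K y
            + ((1 / 2) * divisorPotential g K x + greenConst g K)) := fun y => by
        rw [greenKernel]
        ring
      simp_rw [h]
      have hc1 : Continuous fun y => -(1 / 2) * resistance x y := continuous_const.mul hc
      have hc2 : Continuous fun y => (1 / 2) * divisorPotential g K y := continuous_const.mul hkc
      have hc3 : Continuous fun y => (1 / 2) * divisorPotential g K y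
        + ((1 / 2) * divisorPotential g K x + greenConst g K) := hc2.add continuous_const
      rw [integral_function_add hc1 hc3, integral_function_add hc2 continuous_const,
        integral_function_mul, integral_function_mul, integral_function_const,
        admissibleMeasure_univ hK, integral_resistance_admissibleMeasure, greenConst]
      ring

theorem IsGreenFunction.eq {g : ℕ} {K : Γ →₀ ℤ} (hK : IsPolarization g K) {G H : Γ → Γ → ℝ}
    (hG : IsGreenFunction g K G) (hH : IsGreenFunction g K H) : G = H := by
  ext x y
  obtain ⟨hG1, hG2, hG3⟩ := hG.2 x
  obtain ⟨hH1, hH2, hH3⟩ := hH.2 x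
  have h := sub_eq_of_laplacian_eq hG1.hasGerms hH1.hasGerms (hG2.trans hH2.symm)
  have h1 : (fun z => G x z) = fun z => H x z + (G x y - H x y) :=
    funext fun z => by linarith [h z y]
  rw [h1] at hG3
  have hHc : Continuous fun z => H x z := hH1.1
  rw [integral_function_add hHc continuous_const, hH3, integral_function_const,
    admissibleMeasure_univ hK] at hG3
  linarith

theorem existsUnique_isGreenFunction {g : ℕ} {K : Γ →₀ ℤ} (hK : IsPolarization g K) :
    ∃! G : Γ → Γ → ℝ, IsGreenFunction g K G :=
  ⟨greenKernel g K, isGreenFunction_greenKernel hK,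
    fun _ hG => hG.eq hK (isGreenFunction_greenKernel hK)⟩

theorem greenFunction_self {g : ℕ} {K : Γ →₀ ℤ} (hK : IsPolarization g K) (x : Γ) :
    greenFunction g K x x = divisorPotential g K x + greenConst g K := by
  have h : greenFunction g K = greenKernel g K :=
    (Classical.epsilon_spec (existsUnique_isGreenFunction hK).exists).eq hK
      (isGreenFunction_greenKernel hK)
  rw [h, greenKernel, resistance_self]
  ring

theorem continuous_greenFunction_self {g : ℕ} {K : Γ →₀ ℤ} (hK : IsPolarization g K) :
    Continuous fun x => greenFunction g K x x := by
  simp_rw [greenFunction_self hK]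
  exact (hasGerms_divisorPotential g K).continuous.add continuous_const

/-- In the sum the two copies of the constant cancel ∫D μ_a, leaving ∫D μ_can + 2τ/g = 2τ(g − 1)/g +
2τ/g. -/
theorem integral_greenFunction_self_add {g : ℕ} {K : Γ →₀ ℤ} (hK : IsPolarization g K) :
    ∫ᵛ x, greenFunction g K x x ∂•(admissibleMeasure g K)
      + ∫ᵛ x, greenFunction g K x x ∂•(canonicalMeasure Γ) = 2 * tau Γ := by
  have hg := hK.genus_ne_zero
  have hc : Continuous fun x => divisorPotential g K x := (hasGerms_divisorPotential g K).continuous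
  simp_rw [greenFunction_self hK]
  rw [integral_function_add hc continuous_const, integral_function_add hc continuous_const,
    integral_function_const, integral_function_const, admissibleMeasure_univ hK,
    canonicalMeasure_univ, integral_divisorPotential_canonicalMeasure hK, greenConst]
  field_simp
  ring

theorem integral_greenFunction_self_divisorMeasure {g : ℕ} {K : Γ →₀ ℤ}
    (hK : IsPolarization g K) :
    ∫ᵛ x, greenFunction g K x x ∂•(divisorMeasure K)
      = 2 * (g : ℝ) * ∫ᵛ x, greenFunction g K x x ∂•(admissibleMeasure g K)
        - 2 * ∫ᵛ x, greenFunction g K x x ∂•(canonicalMeasure Γ) := by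
  have hc := continuous_greenFunction_self hK
  rw [divisorMeasure_eq hK, integral_vectorMeasure_sub hc, integral_vectorMeasure_smul,
    integral_vectorMeasure_smul]

theorem totalLength_add_epsilon_sub_phi {g : ℕ} {K : Γ →₀ ℤ} (hK : IsPolarization g K) :
    (1 / 12) * (totalLength Γ + epsilon g K - 2 * phi g K)
      = (1 / 8) * totalLength Γ - (1 / 2) * tau Γ := by
  have hc := continuous_greenFunction_self hK
  rw [epsilon, phi, integral_vectorMeasure_add hc, integral_vectorMeasure_sub hc,
    integral_vectorMeasure_smul, integral_vectorMeasure_smul,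
    integral_greenFunction_self_divisorMeasure hK]
  -- After eliminating δ_K, the quantity ε − 2φ is δ/2 minus 3 times the sum of the two integrals;
  -- dividing by 12 gives the coefficient −1/4.
  linear_combination (-(1 / 4) : ℝ) * integral_greenFunction_self_add hK

end GreenFunction

end MetrizedGraph

end

theorem mainTheorem9 {Γ : Type*} [MetricSpace Γ] [MeasurableSpace Γ] [BorelSpace Γ]
    [IsMetrizedGraph Γ] (g : ℕ) (K : Γ →₀ ℤ) (hK : MetrizedGraph.IsPolarization g K) :
    -- the invariants are well defined
    (μH[1] (univ : Set Γ) ≠ ⊤ ∧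
      (∀ x y : Γ, ∃! R : ℝ, MetrizedGraph.IsEffectiveResistance x y R) ∧
      (∃! μ : SignedMeasure Γ, MetrizedGraph.IsCanonicalMeasure μ) ∧
      (∃! t : ℝ, MetrizedGraph.IsTauInvariant Γ t) ∧
      (∃! G : Γ → Γ → ℝ, MetrizedGraph.IsGreenFunction g K G)) ∧
    -- the identity between them
    (1 / 12) * (MetrizedGraph.totalLength Γ + MetrizedGraph.epsilon g K
        - 2 * MetrizedGraph.phi g K)
      = (1 / 8) * MetrizedGraph.totalLength Γ - (1 / 2) * MetrizedGraph.tau Γ := by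
  exact ⟨⟨measure_ne_top _ _, MetrizedGraph.existsUnique_isEffectiveResistance,
    MetrizedGraph.existsUnique_isCanonicalMeasure, MetrizedGraph.existsUnique_isTauInvariant,
    MetrizedGraph.existsUnique_isGreenFunction hK⟩,
    MetrizedGraph.totalLength_add_epsilon_sub_phi hK⟩
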